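/- For $d,r\in\mathbb N=\{1,2,\dots\}$ let $$\mathcal C^r_d=\{f\in C^r([0,1]^d):\ \|D^\beta f\|_\infty\le 1\ \text{ for all } \beta\in\mathbb N_0^d \text{ with } |\beta|_1\le r\},\qquad S_d(f)=\int_{[0,1]^d}f(x)\,dx .$$ An algorithm $A_n$ that uses $n$ function values has the form $A_n(f)=\phi_n(f(x_1),\dots,f(x_n))$, where $\phi_n:\mathbb R^n\to\mathbb R$ is an arbitrary mapping and the sample points $x_i\in[0,1]^d$ may be chosen adaptively, i.e., $x_i$ may depend on the values $f(x_1),\dots,f(x_{i-1})$ computed before. Let $$e_n(\mathcal C^r_d)=\inf_{A_n}\ \sup_{f\in\mathcal C^r_d}|S_d(f)-A_n(f)|,$$ where the infimum is over all algorithms that use $n$ function values, and let $$n(\varepsilon,d,r)=\min\{n\in\mathbb N_0:\ e_n(\mathcal C^r_d)\le\varepsilon\}.$$ **Theorem.** For any $r,d\in\mathbb N$ and $\varepsilon\in(0,1)$ we have $$n(\varepsilon,d,r)\ \le\ \min_{s=1,2,\dots,r}\ \max\left\{(s+1)^d,\ \left\lceil\left(\frac{\pi}{2}\left(\frac{e}{6\sqrt3}\right)^s\frac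 d\varepsilon\right)^{1/s}\right\rceil^{d}\right\},$$ where $e=\exp(1)$. -/

import Mathlib

open Set MeasureTheory
open scoped ENNReal

noncomputable section

/-- The closed unit cube `[0,1]^d`. -/
def unitCube (d : ℕ) : Set (Fin d → ℝ) := Icc 0 1

/-- The `k`-th partial derivative of `f` in the `j`-th coordinate on the cube `[0,1]^d`
(one-sided at the faces orthogonal to the `j`-th axis). -/
def partialDeriv {d : ℕ} (j : Fin d) (k : ℕ) (f : (Fin d → ℝ) → ℝ) : (Fin d → ℝ) → ℝ :=
  fun x => iteratedDerivWithin k (fun t : ℝ => f (Function.update x j t)) (Icc 0 1) (x j)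

/-- The partial derivative `D^β f` on `[0,1]^d`, where `β` is a multi-index: `β j` derivatives are
taken in the `j`-th coordinate, one coordinate after another. -/
def multiDeriv {d : ℕ} (β : Fin d → ℕ) (f : (Fin d → ℝ) → ℝ) : (Fin d → ℝ) → ℝ :=
  (List.finRange d).foldr (fun j g => partialDeriv j (β j) g) f

/-- The unit ball `C^r_d` of `C^r([0,1]^d)`: the `r` times continuously differentiable functions
on the cube all of whose partial derivatives of order at most `r` are bounded by one in the
sup-norm. A function on the cube is represented by a function on `ℝ^d`, whose values off the cube
play no role. -/
def smoothBall (d r : ℕ) : Set ((Fin d → ℝ) → ℝ) :=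
  {f | ContDiffOn ℝ r f (unitCube d) ∧
    ∀ β : Fin d → ℕ, ∑ j, β j ≤ r → ∀ x ∈ unitCube d, |multiDeriv β f x| ≤ 1}

/-- The integral `S_d(f)` of `f` over `[0,1]^d`. -/
def cubeIntegral (d : ℕ) (f : (Fin d → ℝ) → ℝ) : ℝ := ∫ x in unitCube d, f x

/-- An algorithm on `[0,1]^d` that uses `n` function values. The sample points are chosen
adaptively: the `i`-th point is a function of the values computed before. The output is an
arbitrary, possibly nonlinear, function of the `n` computed values. -/
structure SamplingAlgorithm (d n : ℕ) where
  /-- the choice of the `i`-th sample point, given the values at the previous ones -/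
  node : (i : Fin n) → (Fin i → ℝ) → unitCube d
  /-- the output, given all the values -/
  output : (Fin n → ℝ) → ℝ

/-- The `i`-th function value computed by the algorithm `A` on the input `f`. -/
def SamplingAlgorithm.value {d n : ℕ} (A : SamplingAlgorithm d n) (f : (Fin d → ℝ) → ℝ)
    (i : Fin n) : ℝ :=
  f (A.node i (fun j : Fin i => A.value f ⟨j, j.isLt.trans i.isLt⟩))
termination_by i.val
decreasing_by exact j.isLt

/-- The result `A_n(f)` of the algorithm on the input `f`. -/
def SamplingAlgorithm.run {d n : ℕ} (A : SamplingAlgorithm d n) (f : (Fin d → ℝ) → ℝ) : ℝ :=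
  A.output (A.value f)

/-- The worst case error `e(A_n) = sup |S_d(f) - A_n(f)|` over `f ∈ C^r_d`. -/
def SamplingAlgorithm.worstCaseError {d n : ℕ} (A : SamplingAlgorithm d n) (r : ℕ) : ℝ≥0∞ :=
  ⨆ f ∈ smoothBall d r, ENNReal.ofReal |cubeIntegral d f - A.run f|

/-- The `n`-th minimal worst case error `e_n(C^r_d)`. -/
def minimalError (n d r : ℕ) : ℝ≥0∞ :=
  ⨅ A : SamplingAlgorithm d n, A.worstCaseError r

/-- The minimal number `n(ε, d, r)` of function values with which the error `ε` can be reached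
(it is `⊤` if no number suffices). -/
def minimalNumber (ε : ℝ) (d r : ℕ) : ℕ∞ :=
  ⨅ n ∈ {n : ℕ | minimalError n d r ≤ ENNReal.ofReal ε}, (n : ℕ∞)

end

/-! ### Parseval for derivatives of Chebyshev expansions -/

section ChebyshevEnergy

open Polynomial Polynomial.Chebyshev Finset Real

/-! The upper bound comes from a nonadaptive product rule. Suppose a univariate rule with `m` nodes
has nonnegative weights of sum one and error at most `K` on functions whose `s`-th derivative is
bounded by one. Replacing the integral by the rule one coordinate at a time costs `K` each time,
because both are averages and do not amplify earlier errors; so the product rule with `m ^ d` nodes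
has error at most `d * K` (`abs_integral_pi_sub_sum_le`). Only the pure derivatives of order `s`
matter.

It remains to find, for each `m ≥ s + 1`, such a rule with `K = ruleConst s / m ^ s`
(`hasPositiveRule_of_lt`). A bound of the form `A / n ^ s` survives concatenation of rules on
subintervals of length proportional to their node counts (`HasPositiveRule.add`). Hence midpoint
rules suffice for `s ≤ 2`, and Gauss rules with `s + 1 ≤ k ≤ 2 * s + 1` nodes for `s ≥ 3`.

The Gauss error functional vanishes on `T_i` for `i < 2 * k` and is bounded by `128 / 63` on the
others. The `s`-th derivatives of the `T_i` are orthogonal for a Jacobi weight, so a bound on the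
`s`-th derivative of `P` controls the Chebyshev coefficients of `P` in a weighted `ℓ²` norm.
Cauchy–Schwarz and a telescoping tail sum bound the error (`sq_le_of_vanish_of_abs_T_le`). The worst
case is `k = s + 1`, where the energy grows like `(3s)! / s!`, that is like `(27 * s² / e²) ^ s` up
to powers of `s`; this is the source of `e / (6 * √3)`, the square root of `(e² / 27) / 4`, with the
`4` coming from the interval length. -/

/-- The ratio of the squared norms of the `s`-th derivative of the Chebyshev polynomial `T_n`
in `L²((1 - x²)^(s - 1/2))` and of `T_n` in `L²((1 - x²)^(-1/2))`. -/
noncomputable def chebyshevEnergy (s n : ℕ) : ℝ := ∏ j ∈ range s, ((n : ℝ) ^ 2 - (j : ℝ) ^ 2)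

theorem chebyshevEnergy_succ (s n : ℕ) :
    chebyshevEnergy (s + 1) n = chebyshevEnergy s n * ((n : ℝ) ^ 2 - (s : ℝ) ^ 2) :=
  prod_range_succ _ _

theorem chebyshevEnergy_pos {s n : ℕ} (h : s ≤ n) : 0 < chebyshevEnergy s n := by
  refine prod_pos fun j hj => ?_
  have h1 : (j : ℝ) < n := by exact_mod_cast (mem_range.1 hj).trans_le h
  have h2 : (0 : ℝ) ≤ j := j.cast_nonneg
  nlinarith

theorem chebyshevEnergy_nonneg (s n : ℕ) : 0 ≤ chebyshevEnergy s n := by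
  rcases le_or_gt s n with h | h
  · exact (chebyshevEnergy_pos h).le
  · exact (prod_eq_zero (mem_range.2 h) (sub_self _)).ge

/-- For `1 ≤ s ≤ n` the energy is `n * (n + s - 1)! / (n - s)!`; the identity is the resulting
ratio, cleared of denominators. -/
theorem chebyshevEnergy_shift (s n : ℕ) :
    chebyshevEnergy s (n + 1) * (n * (n - s + 1)) =
      chebyshevEnergy s n * ((n + 1) * (n + s)) := by
  induction s with
  | zero => simp [chebyshevEnergy]; ring
  | succ s ih =>
    rw [chebyshevEnergy_succ, chebyshevEnergy_succ]
    push_cast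
    linear_combination ((n : ℝ) + 1 + s) * (n - s) * ih

/-- Integration by parts `s` times: the differential equation of the `s`-th derivative of `T_n`
gives a factor `n² - s²` at each step, and the boundary terms vanish with `sin`. -/
theorem integral_iterate_derivative_mul_T (P : ℝ[X]) (n s : ℕ) :
    ∫ θ in (0 : ℝ)..π, (derivative^[s] P).eval (cos θ) * (derivative^[s] (T ℝ n)).eval (cos θ) *
      sin θ ^ (2 * s) = chebyshevEnergy s n * ∫ θ in (0 : ℝ)..π, P.eval (cos θ) *
        (T ℝ n).eval (cos θ) := by
  induction s with
  | zero => simp [chebyshevEnergy]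
  | succ s ih =>
    have key : ∀ θ : ℝ, HasDerivAt (fun θ => (derivative^[s] P).eval (cos θ) *
        (derivative^[s + 1] (T ℝ n)).eval (cos θ) * sin θ ^ (2 * s + 1))
        (((n : ℝ) ^ 2 - s ^ 2) * ((derivative^[s] P).eval (cos θ) *
          (derivative^[s] (T ℝ n)).eval (cos θ) * sin θ ^ (2 * s)) -
          (derivative^[s + 1] P).eval (cos θ) * (derivative^[s + 1] (T ℝ n)).eval (cos θ) *
            sin θ ^ (2 * (s + 1))) θ := by
      intro θ
      have h1 := ((derivative^[s] P).hasDerivAt (cos θ)).comp θ (hasDerivAt_cos θ)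
      have h2 := ((derivative^[s + 1] (T ℝ n)).hasDerivAt (cos θ)).comp θ (hasDerivAt_cos θ)
      have h3 := (hasDerivAt_sin θ).pow (2 * s + 1)
      refine ((h1.mul h2).mul h3).congr_deriv ?_
      have ode := one_sub_X_sq_mul_iterate_derivative_T_eval (R := ℝ) n s (cos θ)
      have hs : sin θ ^ 2 = 1 - cos θ ^ 2 := by rw [sin_sq]
      rw [← hs] at ode
      simp only [Function.comp_apply, Pi.mul_apply, Pi.pow_apply,
        ← Function.iterate_succ_apply' (⇑derivative)]
      push_cast at ode ⊢
      simp only [Nat.succ_eq_add_one, mul_add, pow_add, pow_one]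
      linear_combination (-(sin θ ^ (2 * s)) * eval (cos θ) (derivative^[s] P)) * ode
    have hc : ∀ p q : ℝ[X], ∀ m : ℕ, Continuous fun θ : ℝ =>
        p.eval (cos θ) * q.eval (cos θ) * sin θ ^ m := fun p q m => by fun_prop
    have hint := intervalIntegral.integral_eq_sub_of_hasDerivAt (a := 0) (b := π)
      (fun θ _ => key θ) (Continuous.intervalIntegrable
        (((hc _ _ _).const_mul _).sub (hc _ _ _)) _ _)
    rw [intervalIntegral.integral_sub (((hc _ _ _).const_mul _).intervalIntegrable _ _)
      ((hc _ _ _).intervalIntegrable _ _), intervalIntegral.integral_const_mul, ih] at hint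
    simp only [sin_pi, sin_zero, ne_eq, Nat.add_eq_zero_iff, one_ne_zero, and_false,
      not_false_eq_true, zero_pow, mul_zero, sub_self] at hint
    rw [chebyshevEnergy_succ]
    linarith

theorem integral_T_mul_T (n m : ℕ) (hm : m ≠ 0) :
    ∫ θ in (0 : ℝ)..π, (T ℝ n).eval (cos θ) * (T ℝ m).eval (cos θ) =
      if n = m then π / 2 else 0 := by
  rw [← integral_measureT_eq_integral_cos (f := fun x => (T ℝ n).eval x * (T ℝ m).eval x)]
  split_ifs with h
  · subst h
    exact integral_T_real_mul_self_measureT_of_ne_zero hm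
  · exact integral_eval_T_real_mul_eval_T_real_measureT_of_ne h

theorem exists_eq_sum_T (P : ℝ[X]) :
    ∃ (N : ℕ) (a : ℕ → ℝ), P = ∑ n ∈ range N, a n • T ℝ n := by
  have hP : P ∈ degreeLT ℝ (P.natDegree + 1) := by
    rw [mem_degreeLT, degree_lt_iff_coeff_zero]
    intro m hm
    exact coeff_eq_zero_of_natDegree_lt hm
  rw [← Sequence.span_degreeLT (chebyshevTsequence ℝ) (by simp)] at hP
  have hI : (Set.Iio (P.natDegree + 1)) = ((range (P.natDegree + 1) : Finset ℕ) : Set ℕ) := by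
    ext; simp
  rw [hI, Submodule.mem_span_image_finset_iff_exists_fun] at hP
  obtain ⟨c, hc⟩ := hP
  refine ⟨P.natDegree + 1, fun n => if h : n ∈ range (P.natDegree + 1) then c ⟨n, h⟩ else 0, ?_⟩
  refine (hc.symm.trans ?_).trans (sum_coe_sort (range (P.natDegree + 1)) _)
  refine sum_congr rfl fun n _ => ?_
  beta_reduce
  rw [dif_pos n.2]
  rfl

theorem iterate_derivative_sum_smul (s N : ℕ) (a : ℕ → ℝ) (p : ℕ → ℝ[X]) :
    derivative^[s] (∑ n ∈ range N, a n • p n) = ∑ n ∈ range N, a n • derivative^[s] (p n) := by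
  rw [iterate_derivative_sum]
  simp only [iterate_derivative_smul]

/-- Parseval's identity for the `s`-th derivative of a Chebyshev expansion. -/
theorem integral_sq_iterate_derivative_sum_T {s : ℕ} (hs : s ≠ 0) (N : ℕ) (a : ℕ → ℝ) :
    ∫ θ in (0 : ℝ)..π, (derivative^[s] (∑ n ∈ range N, a n • T ℝ n)).eval (cos θ) ^ 2 *
      sin θ ^ (2 * s) = π / 2 * ∑ n ∈ range N, chebyshevEnergy s n * a n ^ 2 := by
  set P : ℝ[X] := ∑ n ∈ range N, a n • T ℝ n with hP
  have h1 : ∀ θ : ℝ, (derivative^[s] P).eval (cos θ) ^ 2 * sin θ ^ (2 * s) =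
      ∑ n ∈ range N, a n * ((derivative^[s] P).eval (cos θ) *
        (derivative^[s] (T ℝ n)).eval (cos θ) * sin θ ^ (2 * s)) := by
    intro θ
    have : (derivative^[s] P).eval (cos θ) =
        ∑ n ∈ range N, a n * (derivative^[s] (T ℝ n)).eval (cos θ) := by
      rw [hP, iterate_derivative_sum_smul, eval_finsetSum]
      simp
    rw [sq]
    nth_rw 2 [this]
    rw [mul_sum, sum_mul]
    exact sum_congr rfl fun n _ => by ring
  simp_rw [h1]
  have hc : ∀ p q : ℝ[X], ∀ m : ℕ, Continuous fun θ : ℝ =>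
      p.eval (cos θ) * q.eval (cos θ) * sin θ ^ m := fun p q m => by fun_prop
  rw [intervalIntegral.integral_finsetSum fun n _ =>
    ((hc _ _ _).const_mul _).intervalIntegrable _ _, mul_sum]
  refine sum_congr rfl fun n hn => ?_
  rw [intervalIntegral.integral_const_mul, integral_iterate_derivative_mul_T]
  -- The constant `T_0` has squared norm `π`, not `π / 2`, but its energy is zero because `s ≠ 0`.
  rcases Nat.eq_zero_or_pos n with rfl | hn0
  · have : chebyshevEnergy s 0 = 0 :=
      prod_eq_zero (mem_range.2 (Nat.pos_of_ne_zero hs)) (by simp)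
    rw [this]; ring
  · have : ∫ θ in (0 : ℝ)..π, P.eval (cos θ) * (T ℝ n).eval (cos θ) = a n * (π / 2) := by
      have h2 : ∀ θ : ℝ, P.eval (cos θ) * (T ℝ n).eval (cos θ) =
          ∑ m ∈ range N, a m * ((T ℝ m).eval (cos θ) * (T ℝ n).eval (cos θ)) := by
        intro θ
        rw [hP, eval_finsetSum, sum_mul]
        exact sum_congr rfl fun m _ => by simp [mul_assoc]
      simp_rw [h2]
      rw [intervalIntegral.integral_finsetSum fun m _ =>
        Continuous.intervalIntegrable (by fun_prop) _ _]
      simp_rw [intervalIntegral.integral_const_mul, integral_T_mul_T _ n hn0.ne']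
      simp [hn]
    rw [this]; ring

/-- A weighted Bessel inequality for the Chebyshev coefficients of a polynomial. -/
theorem sum_chebyshevEnergy_le {s : ℕ} (hs : s ≠ 0) (N : ℕ) (a : ℕ → ℝ) {M : ℝ}
    (hM : ∀ x ∈ Set.Icc (-1 : ℝ) 1,
      |(derivative^[s] (∑ n ∈ range N, a n • T ℝ n)).eval x| ≤ M) :
    ∑ n ∈ range N, chebyshevEnergy s n * a n ^ 2 ≤
      2 * (∏ i ∈ range s, (2 * (i : ℝ) + 1) / (2 * i + 2)) * M ^ 2 := by
  have h1 := integral_sq_iterate_derivative_sum_T hs N a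
  have h2 : ∫ θ in (0 : ℝ)..π, (derivative^[s] (∑ n ∈ range N, a n • T ℝ n)).eval (cos θ) ^ 2 *
      sin θ ^ (2 * s) ≤ ∫ θ in (0 : ℝ)..π, M ^ 2 * sin θ ^ (2 * s) := by
    refine intervalIntegral.integral_mono_on pi_pos.le
      (Continuous.intervalIntegrable (by fun_prop) _ _)
      (Continuous.intervalIntegrable (by fun_prop) _ _) fun θ _ => ?_
    refine mul_le_mul_of_nonneg_right ?_ (by rw [pow_mul]; positivity)
    exact sq_le_sq' (abs_le.1 (hM _ (cos_mem_Icc θ))).1 (abs_le.1 (hM _ (cos_mem_Icc θ))).2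
  rw [h1, intervalIntegral.integral_const_mul, integral_sin_pow_even] at h2
  have := pi_pos
  have h3 : π * (∑ n ∈ range N, chebyshevEnergy s n * a n ^ 2) ≤
    π * (2 * (∏ i ∈ range s, (2 * (i : ℝ) + 1) / (2 * i + 2)) * M ^ 2) := by linarith
  exact le_of_mul_le_mul_left h3 this

end ChebyshevEnergy

/-! ### Tail sums and growth of the energy -/

section ChebyshevEnergyBounds

open Polynomial Polynomial.Chebyshev Finset Real

/-- Telescoping: `(n + s - 1) - (n - s + 1) = 2 * s - 2`, and by the shift identity the next term is
at most the one with numerator `n - s + 1`; only a factor `(n + 1) / n` is lost. -/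
theorem inv_chebyshevEnergy_le_sub {s n : ℕ} (hs : 2 ≤ s) (hn : s ≤ n) :
    (chebyshevEnergy s n)⁻¹ ≤ ((n : ℝ) + s - 1) / ((2 * s - 2) * chebyshevEnergy s n) -
      (((n + 1 : ℕ) : ℝ) + s - 1) / ((2 * s - 2) * chebyshevEnergy s (n + 1)) := by
  have h0 := chebyshevEnergy_pos hn
  have h1 := chebyshevEnergy_pos (hn.trans n.le_succ)
  have h2 := chebyshevEnergy_shift s n
  have hs' : (2 : ℝ) ≤ s := by exact_mod_cast hs
  have hn' : (s : ℝ) ≤ n := by exact_mod_cast hn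
  have h3 : (((n + 1 : ℕ) : ℝ) + s - 1) / ((2 * s - 2) * chebyshevEnergy s (n + 1)) ≤
      (n - s + 1) / ((2 * s - 2) * chebyshevEnergy s n) := by
    rw [div_le_div_iff₀ (by nlinarith) (by nlinarith)]
    push_cast
    have h4 : (chebyshevEnergy s n * ((n : ℝ) + s)) * (n + 1) ≤
        (chebyshevEnergy s (n + 1) * (n - s + 1)) * (n + 1) := by
      have : 0 ≤ chebyshevEnergy s (n + 1) * ((n : ℝ) - s + 1) :=
        mul_nonneg h1.le (by linarith)
      nlinarith
    have h5 := le_of_mul_le_mul_right h4 (by positivity)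
    nlinarith
  have h6 : (chebyshevEnergy s n)⁻¹ = ((n : ℝ) + s - 1) / ((2 * s - 2) * chebyshevEnergy s n) -
      (n - s + 1) / ((2 * s - 2) * chebyshevEnergy s n) := by
    have : (s : ℝ) - 1 ≠ 0 := by linarith
    have : 2 * (s : ℝ) - 2 ≠ 0 := by linarith
    field_simp
    ring
  linarith

theorem sum_inv_chebyshevEnergy_le {s n : ℕ} (hs : 2 ≤ s) (hn : s ≤ n) (m : ℕ) :
    ∑ i ∈ Ico n m, (chebyshevEnergy s i)⁻¹ ≤
      ((n : ℝ) + s - 1) / ((2 * s - 2) * chebyshevEnergy s n) := by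
  have hs' : (2 : ℝ) ≤ s := by exact_mod_cast hs
  have hpos : ∀ i : ℕ, s ≤ i → 0 ≤ ((i : ℝ) + s - 1) / ((2 * s - 2) * chebyshevEnergy s i) := by
    intro i hi
    have h0 := chebyshevEnergy_pos hi
    have : (0 : ℝ) ≤ i := i.cast_nonneg
    exact div_nonneg (by linarith) (mul_nonneg (by linarith) h0.le)
  rcases le_or_gt n m with h | h
  · have key : ∀ m, n ≤ m → ∑ i ∈ Ico n m, (chebyshevEnergy s i)⁻¹ ≤
        ((n : ℝ) + s - 1) / ((2 * s - 2) * chebyshevEnergy s n) -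
        ((m : ℝ) + s - 1) / ((2 * s - 2) * chebyshevEnergy s m) := by
      intro m hm
      induction m, hm using Nat.le_induction with
      | base => simp
      | succ m hm ih =>
        rw [sum_Ico_succ_top hm]
        have := inv_chebyshevEnergy_le_sub hs (hn.trans hm)
        linarith
    linarith [key m h, hpos m (hn.trans h)]
  · rw [Finset.Ico_eq_empty (by omega), sum_empty]
    exact hpos n hn

/-- A linear functional that vanishes on polynomials of degree less than `n` and is bounded by `B`
on the Chebyshev polynomials is bounded in terms of the supremum of the `s`-th derivative. -/
theorem sq_le_of_vanish_of_abs_T_le (L : ℝ[X] →ₗ[ℝ] ℝ) {s n : ℕ} (hs : 2 ≤ s) (hn : s ≤ n) {B : ℝ}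
    (h0 : ∀ i < n, L (T ℝ i) = 0) (hB : ∀ i : ℕ, n ≤ i → |L (T ℝ i)| ≤ B) (P : ℝ[X]) {M : ℝ}
    (hM : ∀ x ∈ Set.Icc (-1 : ℝ) 1, |(derivative^[s] P).eval x| ≤ M) :
    L P ^ 2 ≤ B ^ 2 * (((n : ℝ) + s - 1) / ((2 * s - 2) * chebyshevEnergy s n)) *
      (2 * (∏ i ∈ range s, (2 * (i : ℝ) + 1) / (2 * i + 2)) * M ^ 2) := by
  obtain ⟨N, a, rfl⟩ := exists_eq_sum_T P
  have h1 := sum_chebyshevEnergy_le (by omega) N a hM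
  have h2 := sum_inv_chebyshevEnergy_le hs hn N
  have hL : L (∑ i ∈ range N, a i • T ℝ i) = ∑ i ∈ Ico n N, a i * L (T ℝ i) := by
    rw [map_sum]
    simp only [map_smul, smul_eq_mul]
    symm
    refine sum_subset (fun i hi => mem_range.2 (mem_Ico.1 hi).2) fun i hi hi' => ?_
    rw [h0 i, mul_zero]
    simp only [Finset.mem_range, Finset.mem_Ico] at hi hi'
    omega
  have hB0 : 0 ≤ B := (abs_nonneg _).trans (hB n le_rfl)
  have h3 : (∑ i ∈ Ico n N, chebyshevEnergy s i * a i ^ 2) ≤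
      ∑ i ∈ range N, chebyshevEnergy s i * a i ^ 2 :=
    sum_le_sum_of_subset_of_nonneg (fun i hi => mem_range.2 (mem_Ico.1 hi).2)
      fun i _ _ => mul_nonneg (chebyshevEnergy_nonneg _ _) (sq_nonneg _)
  -- Cauchy–Schwarz with weights `chebyshevEnergy s i` and their inverses.
  have h4 : L (∑ i ∈ range N, a i • T ℝ i) ^ 2 ≤ (∑ i ∈ Ico n N, B ^ 2 * (chebyshevEnergy s i)⁻¹) *
      ∑ i ∈ Ico n N, chebyshevEnergy s i * a i ^ 2 := by
    rw [hL]
    refine sum_sq_le_sum_mul_sum_of_sq_le_mul _ (fun i _ => ?_) (fun i _ => ?_) fun i hi => ?_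
    · exact mul_nonneg (sq_nonneg _) (inv_nonneg.2 (chebyshevEnergy_nonneg _ _))
    · exact mul_nonneg (chebyshevEnergy_nonneg _ _) (sq_nonneg _)
    · have hi' := mem_Ico.1 hi
      have hp := chebyshevEnergy_pos (hn.trans hi'.1)
      have : L (T ℝ i) ^ 2 ≤ B ^ 2 := sq_le_sq' (abs_le.1 (hB i hi'.1)).1 (abs_le.1 (hB i hi'.1)).2
      calc (a i * L (T ℝ i)) ^ 2 = a i ^ 2 * L (T ℝ i) ^ 2 := by ring
        _ ≤ a i ^ 2 * B ^ 2 := by gcongr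
        _ = _ := by field_simp
  rw [← mul_sum] at h4
  refine h4.trans (mul_le_mul (mul_le_mul_of_nonneg_left h2 (sq_nonneg _)) (h3.trans h1)
    (sum_nonneg fun i _ => mul_nonneg (chebyshevEnergy_nonneg _ _) (sq_nonneg _)) ?_)
  exact mul_nonneg (sq_nonneg _)
    (le_trans (sum_nonneg fun i _ => inv_nonneg.2 (chebyshevEnergy_nonneg _ _)) h2)

/-- Each factor `k² / (4 * k² - j²)` decreases in `k`, so among Gauss rules the smallest number of
nodes is the critical one. -/
theorem pow_mul_chebyshevEnergy_le {s m k : ℕ} (hs : s ≤ 2 * m) (h : m ≤ k) :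
    (k : ℝ) ^ (2 * s) * chebyshevEnergy s (2 * m) ≤
      (m : ℝ) ^ (2 * s) * chebyshevEnergy s (2 * k) := by
  have hpow : ∀ x : ℝ, x ^ (2 * s) = ∏ _j ∈ range s, x ^ 2 := by
    intro x; rw [prod_const, card_range, pow_mul]
  rw [hpow, hpow, chebyshevEnergy, chebyshevEnergy, ← prod_mul_distrib, ← prod_mul_distrib]
  have h' : (m : ℝ) ≤ k := by exact_mod_cast h
  have hm0 : (0 : ℝ) ≤ m := m.cast_nonneg
  refine prod_le_prod (fun j hj => ?_) fun j hj => ?_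
  · have : (j : ℝ) ≤ 2 * m := by exact_mod_cast (mem_range.1 hj).le.trans hs
    have h0 : (0 : ℝ) ≤ j := j.cast_nonneg
    push_cast
    exact mul_nonneg (sq_nonneg _) (by nlinarith)
  · push_cast
    have : (m : ℝ) ^ 2 ≤ k ^ 2 := by gcongr
    nlinarith [sq_nonneg (j : ℝ)]

/-- From `log x ≤ sinh (log x) = (x - x⁻¹) / 2` and `exp (-y) ≤ 1 / (1 + y)`. The rational factor
below one is what the induction on `s` needs beyond the limit `e²`. -/
theorem one_add_inv_pow_le {m : ℕ} (hm : 1 ≤ m) :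
    (1 + 1 / (m : ℝ)) ^ (2 * (m - 1)) ≤
      exp 1 ^ 2 * (m * (m + 1) / (m ^ 2 + 4 * m + 1)) := by
  have hm' : (1 : ℝ) ≤ m := by exact_mod_cast hm
  set x : ℝ := 1 + 1 / (m : ℝ) with hx
  have hx0 : 0 < x := by positivity
  have hx1 : 1 ≤ x := by rw [hx]; have : 0 ≤ 1 / (m : ℝ) := by positivity
                         linarith
  have h1 : log x ≤ (2 * m + 1) / (2 * m * (m + 1)) := by
    have := self_le_sinh_iff.2 (log_nonneg hx1)
    rw [sinh_eq, exp_neg, exp_log hx0] at this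
    refine this.trans_eq ?_
    rw [hx]
    field_simp
    ring
  have h2 : ((2 * (m - 1) : ℕ) : ℝ) * log x ≤ 2 - (3 * m + 1) / (m * (m + 1)) := by
    rw [Nat.cast_mul, Nat.cast_sub hm]
    push_cast
    refine (mul_le_mul_of_nonneg_left h1 (by linarith)).trans_eq ?_
    field_simp
    ring
  have h3 : x ^ (2 * (m - 1)) = exp (((2 * (m - 1) : ℕ) : ℝ) * log x) := by
    rw [exp_nat_mul, exp_log hx0]
  rw [h3]
  refine (exp_le_exp.2 h2).trans ?_
  rw [exp_sub, ← exp_nat_mul, div_eq_mul_inv]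
  push_cast
  rw [mul_one]
  refine mul_le_mul_of_nonneg_left ?_ (exp_pos _).le
  have h4 := add_one_le_exp ((3 * (m : ℝ) + 1) / (m * (m + 1)))
  have h5 : (0 : ℝ) < (3 * (m : ℝ) + 1) / (m * (m + 1)) + 1 := by positivity
  refine (inv_anti₀ h5 h4).trans_eq ?_
  field_simp
  ring

theorem chebyshevEnergy_succ_two_mul (s : ℕ) :
    chebyshevEnergy (s + 1) (2 * (s + 1 + 1)) * ((2 * s + 2) * (s + 3)) =
      chebyshevEnergy s (2 * (s + 1)) * ((2 * s + 4) * (3 * s + 4) * (3 * s + 3) * (3 * s + 2)) := by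
  have h1 := chebyshevEnergy_shift s (2 * (s + 1))
  have h2 := chebyshevEnergy_shift s (2 * (s + 1) + 1)
  rw [chebyshevEnergy_succ, show 2 * (s + 1 + 1) = 2 * (s + 1) + 1 + 1 by ring]
  push_cast at *
  have h3 : ((2 : ℝ) * (s + 1) + 1) ≠ 0 := by positivity
  have h4 : ((s : ℝ) + 4) ≠ 0 := by positivity
  apply mul_right_cancel₀ h3
  linear_combination ((3 * s + 4) * (2 * s + 2) * (s + 3) : ℝ) * h2 +
    ((2 * s + 4) * (3 * s + 3) * (3 * s + 4) : ℝ) * h1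

/-- Induction on `s`: the case `s = 3` is numerical, and the left side then grows by a factor of at
most `e² / 27` per step. -/
theorem chebyshevEnergy_numeric_bound {s : ℕ} (hs : 3 ≤ s) :
    (128 / 63) ^ 2 * (2 * ∏ i ∈ range s, (2 * (i : ℝ) + 1) / (2 * i + 2)) *
      ((5 * s + 1) / (2 * s - 2)) * ((s + 1 : ℕ) : ℝ) ^ (2 * s) / chebyshevEnergy s (2 * (s + 1)) ≤
      π ^ 2 * (exp 1 ^ 2 / 27) ^ s := by
  induction s, hs using Nat.le_induction with
  | base =>
    have he : (2.718 : ℝ) ≤ exp 1 := by linarith [exp_one_gt_d9]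
    have hp : (3.14 : ℝ) ≤ π := by linarith [pi_gt_d2]
    have h : (3.14 : ℝ) ^ 2 * (2.718 ^ 2 / 27) ^ 3 ≤ π ^ 2 * (exp 1 ^ 2 / 27) ^ 3 := by gcongr
    refine le_trans ?_ h
    norm_num [chebyshevEnergy, prod_range_succ]
  | succ s hs ih =>
    have hsr : (3 : ℝ) ≤ s := by exact_mod_cast hs
    have hE := chebyshevEnergy_pos (s := s) (n := 2 * (s + 1)) (by omega)
    have hE' := chebyshevEnergy_pos (s := s + 1) (n := 2 * (s + 1 + 1)) (by omega)
    have h1 := one_add_inv_pow_le (m := s + 1) (by omega)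
    have h2 := chebyshevEnergy_succ_two_mul s
    rw [Nat.add_sub_cancel] at h1
    set W : ℝ := ∏ i ∈ range s, (2 * (i : ℝ) + 1) / (2 * i + 2) with hW
    have hW0 : 0 < W := prod_pos fun i _ => by positivity
    set A : ℝ := ((s + 1 : ℕ) : ℝ) ^ (2 * s) with hA
    have hA0 : 0 < A := by positivity
    set q : ℝ := (1 + 1 / ((s + 1 : ℕ) : ℝ)) ^ (2 * s) with hq
    have hq0 : 0 < q := by positivity
    have hpow : ((s + 1 + 1 : ℕ) : ℝ) ^ (2 * (s + 1)) = A * q * (s + 2) ^ 2 := by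
      rw [hA, hq, ← mul_pow, mul_add, pow_add]
      push_cast
      have : ((s : ℝ) + 1) * (1 + 1 / (s + 1)) = s + 2 := by field_simp; ring
      rw [this]
      ring_nf
    have hEe : chebyshevEnergy (s + 1) (2 * (s + 1 + 1)) = chebyshevEnergy s (2 * (s + 1)) *
        ((2 * s + 4) * (3 * s + 4) * (3 * s + 3) * (3 * s + 2)) / ((2 * s + 2) * (s + 3)) := by
      rw [← h2]; field_simp
    rw [prod_range_succ, ← hW, hpow, hEe]
    set E := chebyshevEnergy s (2 * (s + 1))
    -- The ratio of the left sides at `s + 1` and `s` is `r * q`, with `r` rational in `s` and `q`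
    -- the power of `1 + 1 / (s + 1)`.
    set r : ℝ := (2 * s + 1) / (2 * s + 2) * ((5 * s + 6) / (2 * s) * ((2 * s - 2) / (5 * s + 1))) *
      (s + 2) ^ 2 * ((2 * s + 2) * (s + 3)) / ((2 * s + 4) * (3 * s + 4) * (3 * s + 3) * (3 * s + 2))
      with hr
    have hm2 : (2 * (s : ℝ) - 2) > 0 := by linarith
    have hr0 : 0 ≤ r := by rw [hr]; positivity
    -- `r` tends to `1 / 27` from above, so `q ≤ e²` alone would fail; the correction in `h1`
    -- compensates.
    have hrq : r * q ≤ exp 1 ^ 2 / 27 := by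
      refine (mul_le_mul_of_nonneg_left h1 hr0).trans ?_
      have : r * (((s + 1 : ℕ) : ℝ) * ((s + 1 : ℕ) + 1) /
          (((s + 1 : ℕ) : ℝ) ^ 2 + 4 * (s + 1 : ℕ) + 1)) ≤ 1 / 27 := by
        rw [hr]
        push_cast
        obtain ⟨t, ht⟩ : ∃ t : ℝ, (s : ℝ) = t + 3 := ⟨s - 3, by ring⟩
        have ht0 : 0 ≤ t := by linarith
        rw [ht]
        have : 2 * (t + 3) - 2 = 2 * t + 4 := by ring
        rw [this]
        field_simp
        rw [← sub_nonneg]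
        ring_nf
        positivity
      rw [mul_left_comm, ← mul_one_div (exp 1 ^ 2)]
      exact mul_le_mul_of_nonneg_left this (by positivity)
    have hl : (128 / 63) ^ 2 * (2 * (W * ((2 * (s : ℝ) + 1) / (2 * s + 2)))) *
        ((5 * ((s + 1 : ℕ) : ℝ) + 1) / (2 * ((s + 1 : ℕ) : ℝ) - 2)) * (A * q * (s + 2) ^ 2) /
        (E * ((2 * s + 4) * (3 * s + 4) * (3 * s + 3) * (3 * s + 2)) / ((2 * s + 2) * (s + 3))) =
        ((128 / 63) ^ 2 * (2 * W) * ((5 * s + 1) / (2 * s - 2)) * A / E) * (r * q) := by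
      rw [hr]
      push_cast
      have e1 : 2 * ((s : ℝ) + 1) - 2 = 2 * s := by ring
      have e2 : 5 * ((s : ℝ) + 1) + 1 = 5 * s + 6 := by ring
      have : (s : ℝ) - 1 ≠ 0 := by linarith
      rw [e1, e2]
      field_simp
    rw [hl, pow_succ (exp 1 ^ 2 / 27), ← mul_assoc (π ^ 2)]
    have hrq0 : 0 ≤ r * q := mul_nonneg hr0 hq0.le
    exact mul_le_mul ih hrq hrq0 (by positivity)

end ChebyshevEnergyBounds

/-! ### Gauss–Legendre rules from the spectral theorem -/

section GaussLegendre

open Polynomial Finset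

/-- The `L²(-1, 1)` inner product on real polynomials. -/
@[reducible] noncomputable def legendreCore : InnerProductSpace.Core ℝ ℝ[X] where
  inner p q := ∫ x in (-1 : ℝ)..1, p.eval x * q.eval x
  conj_inner_symm p q := by simp [mul_comm]
  re_inner_nonneg p := intervalIntegral.integral_nonneg (by norm_num) fun x _ =>
    mul_self_nonneg (p.eval x)
  add_left p q r := by
    simp only [eval_add, add_mul]
    exact intervalIntegral.integral_add (Continuous.intervalIntegrable (by fun_prop) _ _)
      (Continuous.intervalIntegrable (by fun_prop) _ _)
  smul_left p q c := by
    simp [mul_assoc]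
  definite p h := by
    by_contra hp
    have hc : ContinuousOn (fun x => p.eval x * p.eval x) (Set.Icc (-1 : ℝ) 1) := by fun_prop
    have h0 : ∀ x ∈ Set.Icc (-1 : ℝ) 1, p.eval x = 0 := by
      intro x hx
      by_contra hne
      have := intervalIntegral.integral_pos (by norm_num : (-1 : ℝ) < 1) hc
        (fun y _ => mul_self_nonneg _) ⟨x, hx, mul_self_pos.2 hne⟩
      exact this.ne' h
    refine (p.roots.toFinset.finite_toSet).not_infinite
      ((Set.Icc_infinite (by norm_num : (-1 : ℝ) < 1)).mono fun x hx => ?_)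
    simpa [hp] using h0 x hx

theorem linearMap_apply_eq_of_X_pow (n : ℕ) (P : ℝ[X]) (hP : P.natDegree < n) (L : ℝ[X] →ₗ[ℝ] ℝ)
    (L' : ℝ[X] →ₗ[ℝ] ℝ) (h : ∀ m < n, L (X ^ m) = L' (X ^ m)) : L P = L' P := by
  rw [P.as_sum_range' n hP, map_sum, map_sum]
  refine sum_congr rfl fun m hm => ?_
  rw [← mul_one (P.coeff m), ← smul_eq_mul, ← smul_monomial, map_smul, map_smul,
    ← X_pow_eq_monomial, h m (mem_range.1 hm)]

/-- Integration over `[-1, 1]` as a linear functional on polynomials. -/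
noncomputable def legendreIntegral : ℝ[X] →ₗ[ℝ] ℝ where
  toFun p := ∫ x in (-1 : ℝ)..1, p.eval x
  map_add' p q := by
    simp only [eval_add]
    exact intervalIntegral.integral_add (Continuous.intervalIntegrable (by fun_prop) _ _)
      (Continuous.intervalIntegrable (by fun_prop) _ _)
  map_smul' c p := by simp

/-- The quadrature rule with nodes `x` and weights `w` as a linear functional on polynomials. -/
noncomputable def quadratureSum {n : ℕ} (x w : Fin n → ℝ) : ℝ[X] →ₗ[ℝ] ℝ where
  toFun p := ∑ i, w i * p.eval (x i)
  map_add' p q := by simp [mul_add, sum_add_distrib]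
  map_smul' c p := by simp [mul_sum, mul_left_comm]

/-- Gauss-Legendre quadrature. The nodes are the eigenvalues of the compression of the
multiplication by `X` to the polynomials of degree less than `k`. -/
theorem exists_gauss_rule {k : ℕ} (hk : 1 ≤ k) : ∃ x w : Fin k → ℝ,
    (∀ i, x i ∈ Set.Icc (-1 : ℝ) 1) ∧ (∀ i, 0 ≤ w i) ∧
    ∀ P : ℝ[X], P.natDegree < 2 * k → quadratureSum x w P = legendreIntegral P := by
  let : NormedAddCommGroup ℝ[X] := legendreCore.toNormedAddCommGroup
  let : InnerProductSpace ℝ ℝ[X] := InnerProductSpace.ofCore legendreCore.toCore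
  have hinner : ∀ p q : ℝ[X], inner ℝ p q = ∫ x in (-1 : ℝ)..1, p.eval x * q.eval x :=
    fun p q => rfl
  let E : Submodule ℝ ℝ[X] := degreeLT ℝ k
  have : FiniteDimensional ℝ E := (degreeLTEquiv ℝ k).symm.finiteDimensional
  have hfin : Module.finrank ℝ E = k := by
    rw [(degreeLTEquiv ℝ k).finrank_eq, Module.finrank_fin_fun]
  let T : E →ₗ[ℝ] E := (E.orthogonalProjectionOnto : ℝ[X] →ₗ[ℝ] E) ∘ₗ
    (LinearMap.mulLeft ℝ (X : ℝ[X])) ∘ₗ E.subtype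
  have hT : ∀ p q : E, inner ℝ (T p) q = inner ℝ (X * (p : ℝ[X])) (q : ℝ[X]) := by
    intro p q
    exact Submodule.inner_orthogonalProjectionOnto_eq_of_mem_right q _
  have hsymm : T.IsSymmetric := by
    intro p q
    rw [hT, ← real_inner_comm p (T q), hT, hinner, hinner]
    congr 1; ext x; simp; ring
  let e := hsymm.eigenvectorBasis hfin
  let l := hsymm.eigenvalues hfin
  have hl : ∀ i, T (e i) = l i • e i := fun i => hsymm.apply_eigenvectorBasis hfin i
  have hinner_e : ∀ (p : E) (i : Fin k), inner ℝ p (l i • e i) = l i * inner ℝ p (e i) :=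
    fun p i => real_inner_smul_right (F := E) p (e i) (l i)
  have hmem : ∀ m < k, (X ^ m : ℝ[X]) ∈ E := by
    intro m hm
    rw [mem_degreeLT, degree_X_pow]
    exact_mod_cast hm
  let c : Fin k → ℝ := fun i => inner ℝ (1 : ℝ[X]) (e i : ℝ[X])
  -- Projecting does not change inner products with `e i ∈ E`, so multiplication by `X` acts on
  -- these coefficients as `l i`.
  have hpow : ∀ m < k, ∀ i, inner ℝ (X ^ m : ℝ[X]) (e i : ℝ[X]) = l i ^ m * c i := by
    intro m
    induction m with
    | zero => intro _ i; simp [c]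
    | succ m ih =>
      intro hm i
      have h1 := hT ⟨X ^ m, hmem m (by omega)⟩ (e i)
      rw [hsymm, hl, hinner_e, Submodule.coe_inner, ih (by omega)] at h1
      rw [pow_succ', ← h1]
      ring
  have hsum : ∀ p q : E, inner ℝ (p : ℝ[X]) (q : ℝ[X]) =
      ∑ i, inner ℝ (p : ℝ[X]) (e i : ℝ[X]) * inner ℝ (q : ℝ[X]) (e i : ℝ[X]) := by
    intro p q
    have := e.sum_inner_mul_inner p q
    simp only [Submodule.coe_inner] at this
    rw [← this]
    exact sum_congr rfl fun i _ => by rw [real_inner_comm (q : ℝ[X])]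
  refine ⟨l, fun i => c i ^ 2, fun i => ?_, fun i => sq_nonneg _, fun P hP => ?_⟩
  -- A node is a Rayleigh quotient of multiplication by `x`, hence an average of `x` over `[-1, 1]`.
  · have hnorm : inner ℝ (e i) (e i) = (1 : ℝ) := by
      rw [real_inner_self_eq_norm_sq, e.orthonormal.1 i]; norm_num
    have h1 : l i = inner ℝ (X * (e i : ℝ[X])) (e i : ℝ[X]) := by
      rw [← hT, hsymm, hl, hinner_e, hnorm, mul_one]
    rw [Submodule.coe_inner, hinner] at hnorm
    rw [hinner] at h1
    constructor
    · have : ∫ x in (-1 : ℝ)..1, -((e i : ℝ[X]).eval x * (e i : ℝ[X]).eval x) ≤ l i := by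
        rw [h1]
        refine intervalIntegral.integral_mono_on (by norm_num)
          (Continuous.intervalIntegrable (by fun_prop) _ _)
          (Continuous.intervalIntegrable (by fun_prop) _ _) fun x hx => ?_
        simp only [eval_mul, eval_X]
        nlinarith [hx.1, mul_self_nonneg ((e i : ℝ[X]).eval x)]
      rwa [intervalIntegral.integral_neg, hnorm] at this
    · have : l i ≤ ∫ x in (-1 : ℝ)..1, (e i : ℝ[X]).eval x * (e i : ℝ[X]).eval x := by
        rw [h1]
        refine intervalIntegral.integral_mono_on (by norm_num)
          (Continuous.intervalIntegrable (by fun_prop) _ _)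
          (Continuous.intervalIntegrable (by fun_prop) _ _) fun x hx => ?_
        simp only [eval_mul, eval_X]
        nlinarith [hx.2, mul_self_nonneg ((e i : ℝ[X]).eval x)]
      exact this.trans_eq hnorm
  · refine linearMap_apply_eq_of_X_pow (2 * k) P hP _ _ fun m hm => ?_
    have hlow : ∀ a < k, ∀ b < k, ∑ i, c i ^ 2 * l i ^ (a + b) =
        ∫ x in (-1 : ℝ)..1, x ^ (a + b) := by
      intro a ha b hb
      have := hsum ⟨X ^ a, hmem a ha⟩ ⟨X ^ b, hmem b hb⟩
      simp only [hpow a ha, hpow b hb, hinner, eval_pow, eval_X, ← pow_add] at this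
      rw [this]
      exact sum_congr rfl fun i _ => by ring
    have hgoal : ∑ i, c i ^ 2 * l i ^ m = ∫ x in (-1 : ℝ)..1, x ^ m := by
      rcases lt_or_ge m (2 * k - 1) with h | h
      · have := hlow (min m (k - 1)) (by omega) (m - min m (k - 1)) (by omega)
        rwa [show min m (k - 1) + (m - min m (k - 1)) = m by omega] at this
      -- The top degree `2 * k - 1` is not a sum of two exponents below `k`; expanding `⟨T u, u⟩`
      -- with `u = X ^ (k - 1)` supplies the extra factor `l i`.
      · obtain rfl : m = (k - 1) + (k - 1) + 1 := by omega
        have hk1 : k - 1 < k := by omega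
        set u : E := ⟨X ^ (k - 1), hmem (k - 1) hk1⟩ with hu
        have h1 := hT u u
        have h2 := hsum (T u) u
        have hue : ∀ i, inner ℝ (u : ℝ[X]) (e i : ℝ[X]) = l i ^ (k - 1) * c i := hpow _ hk1
        rw [← Submodule.coe_inner, h1, hinner] at h2
        have h3 : ∀ i, inner ℝ ((T u : E) : ℝ[X]) (e i : ℝ[X]) = l i * (l i ^ (k - 1) * c i) := by
          intro i
          rw [← Submodule.coe_inner, hsymm, hl, hinner_e, Submodule.coe_inner, hue]
        simp only [h3, hue] at h2
        simp only [hu, eval_mul, eval_pow, eval_X] at h2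
        have h4 : ∀ x : ℝ, x ^ (k - 1 + (k - 1) + 1) = x * x ^ (k - 1) * x ^ (k - 1) := by
          intro x; ring
        simp only [h4]
        rw [h2]
        exact sum_congr rfl fun i _ => by ring
    simpa [quadratureSum, legendreIntegral] using hgoal

end GaussLegendre

/-! ### Univariate positive rules of order `s` -/

section UnivariateRules

open Polynomial Polynomial.Chebyshev Finset

theorem abs_integral_T_le {n : ℕ} (hn : 2 ≤ n) :
    |legendreIntegral (T ℝ n)| ≤ 2 / ((n : ℝ) ^ 2 - 1) := by
  have hn' : (2 : ℝ) ≤ n := by exact_mod_cast hn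
  have hp : (n : ℝ) + 1 ≠ 0 := by positivity
  have hm : (n : ℝ) - 1 ≠ 0 := by linarith
  have hd : ∀ x : ℝ, HasDerivAt (fun x => ((T ℝ (n + 1)).eval x / (n + 1) -
      (T ℝ (n - 1)).eval x / (n - 1)) / 2) ((T ℝ n).eval x) x := by
    intro x
    refine (((((T ℝ (n + 1)).hasDerivAt x).div_const _).sub
      (((T ℝ (n - 1)).hasDerivAt x).div_const _)).div_const 2).congr_deriv ?_
    rw [T_derivative_eq_U, T_derivative_eq_U]
    have h := congrArg (eval x) (two_mul_T_eq_U_sub_U ℝ ((n : ℤ) - 2))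
    rw [sub_add_cancel] at h
    rw [show (n : ℤ) + 1 - 1 = n by ring, show (n : ℤ) - 1 - 1 = n - 2 by ring]
    simp only [eval_mul, eval_sub, eval_ofNat, eval_intCast] at h ⊢
    push_cast
    field_simp
    linarith
  have hI : legendreIntegral (T ℝ n) = ∫ x in (-1 : ℝ)..1, (T ℝ n).eval x := rfl
  rw [hI, intervalIntegral.integral_eq_sub_of_hasDerivAt (fun x _ => hd x)
    (Continuous.intervalIntegrable (by fun_prop) _ _)]
  simp only [T_eval_one, T_eval_neg_one]
  have hpar : (((n : ℤ) + 1).negOnePow : ℤ) = (((n : ℤ) - 1).negOnePow : ℤ) := by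
    rw [show (n : ℤ) + 1 = (n - 1) + 2 by ring, Int.negOnePow_add,
      Int.negOnePow_even 2 even_two, mul_one]
  have hsgn : ((((n : ℤ) - 1).negOnePow : ℤ) : ℝ) = 1 ∨
      ((((n : ℤ) - 1).negOnePow : ℤ) : ℝ) = -1 := by
    rcases Int.even_or_odd ((n : ℤ) - 1) with h | h
    · left; simp [Int.negOnePow_even _ h]
    · right; simp [Int.negOnePow_odd _ h]
  have hpos : 0 < (n : ℝ) ^ 2 - 1 := by nlinarith
  rw [hpar]
  rcases hsgn with h | h <;> rw [h]
  · simp only [sub_self, abs_zero]; positivity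
  · rw [show (1 / ((n : ℝ) + 1) - 1 / (n - 1)) / 2 - (-1 / ((n : ℝ) + 1) - -1 / (n - 1)) / 2 =
      -(2 / ((n : ℝ) ^ 2 - 1)) by
        rw [show (n : ℝ) ^ 2 - 1 = (n + 1) * (n - 1) by ring]
        field_simp
        ring, abs_neg, abs_of_pos (by positivity)]

theorem abs_quadratureSum_le {n : ℕ} {x w : Fin n → ℝ} (hw : ∀ i, 0 ≤ w i) {P : ℝ[X]} {M : ℝ}
    (hP : ∀ i, |P.eval (x i)| ≤ M) : |quadratureSum x w P| ≤ (∑ i, w i) * M := by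
  rw [sum_mul]
  refine (abs_sum_le_sum_abs (fun i => w i * P.eval (x i)) univ).trans (sum_le_sum fun i _ => ?_)
  rw [abs_mul, abs_of_nonneg (hw i)]
  exact mul_le_mul_of_nonneg_left (hP i) (hw i)

/-- There is a quadrature rule on `[0, 1]` with `n` nodes and nonnegative weights that sum to one,
whose error is at most `C` times the supremum of the `s`-th derivative, on polynomials. -/
def HasPositiveRule (s n : ℕ) (C : ℝ) : Prop :=
  ∃ x w : Fin n → ℝ, (∀ i, x i ∈ Set.Icc (0 : ℝ) 1) ∧ (∀ i, 0 ≤ w i) ∧ ∑ i, w i = 1 ∧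
    ∀ (P : ℝ[X]) (M : ℝ), (∀ t ∈ Set.Icc (0 : ℝ) 1, |(derivative^[s] P).eval t| ≤ M) →
      |(∫ t in (0 : ℝ)..1, P.eval t) - quadratureSum x w P| ≤ C * M

theorem eval_iterate_derivative_comp_affine (P : ℝ[X]) (a b : ℝ) (s : ℕ) (t : ℝ) :
    (derivative^[s] (P.comp (C a * X + C b))).eval t =
      a ^ s * (derivative^[s] P).eval (a * t + b) := by
  have : derivative^[s] (P.comp (C a * X + C b)) =
      C (a ^ s) * (derivative^[s] P).comp (C a * X + C b) := by
    induction s with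
    | zero => simp
    | succ s ih =>
      rw [Function.iterate_succ_apply', ih, derivative_C_mul, derivative_comp,
        Function.iterate_succ_apply']
      simp only [derivative_add, derivative_mul, derivative_C, derivative_X, pow_succ,
        Polynomial.C_mul]
      ring
  rw [this]
  simp

theorem integral_comp_affine (P : ℝ[X]) (a b c d : ℝ) :
    a * ∫ t in c..d, (P.comp (C a * X + C b)).eval t =
      ∫ t in (a * c + b)..(a * d + b), P.eval t := by
  rw [← intervalIntegral.mul_integral_comp_mul_add (f := fun t => P.eval t)]
  simp

/-- With pieces of length `l` and `m` proportional to the node counts, the first contributes `l * l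
^ s * A / n₁ ^ s = l * A / (n₁ + n₂) ^ s`, likewise the second, and `l + m = 1`. -/
theorem HasPositiveRule.add {s n₁ n₂ : ℕ} {A : ℝ} (h₁ : HasPositiveRule s n₁ (A / n₁ ^ s))
    (h₂ : HasPositiveRule s n₂ (A / n₂ ^ s)) (hn₁ : 0 < n₁) (hn₂ : 0 < n₂) :
    HasPositiveRule s (n₁ + n₂) (A / ((n₁ + n₂ : ℕ) : ℝ) ^ s) := by
  obtain ⟨x₁, w₁, hx₁, hw₁, hs₁, he₁⟩ := h₁
  obtain ⟨x₂, w₂, hx₂, hw₂, hs₂, he₂⟩ := h₂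
  have p₁ : (0 : ℝ) < n₁ := by exact_mod_cast hn₁
  have p₂ : (0 : ℝ) < n₂ := by exact_mod_cast hn₂
  set l : ℝ := n₁ / (n₁ + n₂) with hl
  set m : ℝ := n₂ / (n₁ + n₂) with hm
  have hl0 : 0 < l := by positivity
  have hm0 : 0 < m := by positivity
  have hlm : l + m = 1 := by rw [hl, hm]; field_simp
  refine ⟨Fin.append (fun i => l * x₁ i) (fun i => m * x₂ i + l),
    Fin.append (fun i => l * w₁ i) (fun i => m * w₂ i), fun i => ?_, fun i => ?_, ?_,
    fun P M hM => ?_⟩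
  · refine Fin.addCases (fun i => ?_) (fun i => ?_) i
    · rw [Fin.append_left]
      constructor <;> nlinarith [(hx₁ i).1, (hx₁ i).2]
    · rw [Fin.append_right]
      constructor <;> nlinarith [(hx₂ i).1, (hx₂ i).2]
  · refine Fin.addCases (fun i => ?_) (fun i => ?_) i
    · rw [Fin.append_left]; exact mul_nonneg hl0.le (hw₁ i)
    · rw [Fin.append_right]; exact mul_nonneg hm0.le (hw₂ i)
  · rw [Fin.sum_univ_add]
    simp only [Fin.append_left, Fin.append_right, ← mul_sum, hs₁, hs₂]
    linarith
  · have e₁ := he₁ (P.comp (C l * X + C 0)) (l ^ s * M) fun t ht => by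
      rw [eval_iterate_derivative_comp_affine, abs_mul, abs_of_pos (pow_pos hl0 s)]
      refine mul_le_mul_of_nonneg_left (hM _ ⟨?_, ?_⟩) (pow_pos hl0 s).le <;>
        nlinarith [ht.1, ht.2]
    have e₂ := he₂ (P.comp (C m * X + C l)) (m ^ s * M) fun t ht => by
      rw [eval_iterate_derivative_comp_affine, abs_mul, abs_of_pos (pow_pos hm0 s)]
      refine mul_le_mul_of_nonneg_left (hM _ ⟨?_, ?_⟩) (pow_pos hm0 s).le <;>
        nlinarith [ht.1, ht.2]
    have i₁ := integral_comp_affine P l 0 0 1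
    have i₂ := integral_comp_affine P m l 0 1
    rw [mul_zero, mul_one, zero_add, add_zero] at i₁
    rw [mul_zero, mul_one, zero_add, add_comm m l, hlm] at i₂
    have hsplit : (∫ t in (0 : ℝ)..1, P.eval t) =
        (∫ t in (0 : ℝ)..l, P.eval t) + ∫ t in l..1, P.eval t :=
      (intervalIntegral.integral_add_adjacent_intervals
        (Continuous.intervalIntegrable (by fun_prop) _ _)
        (Continuous.intervalIntegrable (by fun_prop) _ _)).symm
    have hq : quadratureSum (Fin.append (fun i => l * x₁ i) (fun i => m * x₂ i + l))
        (Fin.append (fun i => l * w₁ i) (fun i => m * w₂ i)) P =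
        l * quadratureSum x₁ w₁ (P.comp (C l * X + C 0)) +
          m * quadratureSum x₂ w₂ (P.comp (C m * X + C l)) := by
      simp only [quadratureSum, LinearMap.coe_mk, AddHom.coe_mk, Fin.sum_univ_add,
        Fin.append_left, Fin.append_right, mul_sum, eval_comp, eval_add, eval_mul, eval_C, eval_X,
        add_zero, mul_assoc]
    rw [hsplit, hq, ← i₁, ← i₂]
    set I₁ := ∫ t in (0 : ℝ)..1, (P.comp (C l * X + C 0)).eval t
    set I₂ := ∫ t in (0 : ℝ)..1, (P.comp (C m * X + C l)).eval t
    rw [show l * I₁ + m * I₂ - (l * quadratureSum x₁ w₁ (P.comp (C l * X + C 0)) +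
          m * quadratureSum x₂ w₂ (P.comp (C m * X + C l))) =
        l * (I₁ - quadratureSum x₁ w₁ (P.comp (C l * X + C 0))) +
          m * (I₂ - quadratureSum x₂ w₂ (P.comp (C m * X + C l))) by ring]
    refine (abs_add_le _ _).trans ?_
    rw [abs_mul, abs_mul, abs_of_pos hl0, abs_of_pos hm0]
    refine (add_le_add (mul_le_mul_of_nonneg_left e₁ hl0.le)
      (mul_le_mul_of_nonneg_left e₂ hm0.le)).trans_eq ?_
    have c₁ : A / (n₁ : ℝ) ^ s * (l ^ s * M) = A / (n₁ + n₂) ^ s * M := by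
      rw [hl, div_pow]; field_simp
    have c₂ : A / (n₂ : ℝ) ^ s * (m ^ s * M) = A / (n₁ + n₂) ^ s * M := by
      rw [hm, div_pow]; field_simp
    rw [c₁, c₂, ← add_mul, hlm, one_mul]
    push_cast
    rfl

/-- The constant in the error bound for univariate quadrature of functions with smoothness `s`. -/
noncomputable def ruleConst (s : ℕ) : ℝ := Real.pi / 2 * (Real.exp 1 / (6 * √3)) ^ s

theorem ruleConst_pos (s : ℕ) : 0 < ruleConst s := by
  have := Real.pi_pos
  unfold ruleConst
  positivity

theorem four_mul_ruleConst_sq (s : ℕ) :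
    4 * ruleConst s ^ 2 = Real.pi ^ 2 * (Real.exp 1 ^ 2 / 27) ^ s / 4 ^ s := by
  have h : (6 * √3) ^ 2 = 27 * 4 := by rw [mul_pow, Real.sq_sqrt (by norm_num)]; norm_num
  rw [ruleConst, mul_pow, ← pow_mul, mul_comm s 2, pow_mul, div_pow (Real.exp 1), h, ← div_div,
    div_pow _ (4 : ℝ)]
  ring

/-- The lower bound on `k` permits reduction to `k = s + 1`; the upper bound turns `2 * k + s - 1`
into at most `5 * s + 1`. -/
theorem hasPositiveRule_gauss {s k : ℕ} (hs : 3 ≤ s) (hk : s + 1 ≤ k) (hk' : k ≤ 2 * s + 1) :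
    HasPositiveRule s k (ruleConst s / k ^ s) := by
  obtain ⟨x, w, hx, hw, hex⟩ := exists_gauss_rule (show 1 ≤ k by omega)
  have hw2 : ∑ i, w i = 2 := by
    have := hex 1 (by rw [natDegree_one]; omega)
    simpa [quadratureSum, legendreIntegral, one_add_one_eq_two] using this
  refine ⟨fun i => 1 / 2 * x i + 1 / 2, fun i => w i / 2, fun i => ?_, fun i => ?_, ?_,
    fun P M hM => ?_⟩
  · constructor <;> linarith [(hx i).1, (hx i).2]
  · linarith [hw i]
  · rw [← sum_div, hw2]; norm_num
  · set Q : ℝ[X] := P.comp (C (1 / 2) * X + C (1 / 2)) with hQ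
    have hI : (∫ t in (0 : ℝ)..1, P.eval t) = 1 / 2 * legendreIntegral Q := by
      have := integral_comp_affine P (1 / 2) (1 / 2) (-1) 1
      norm_num at this
      rw [← this]
      norm_num [legendreIntegral, hQ]
    have hS : quadratureSum (fun i => 1 / 2 * x i + 1 / 2) (fun i => w i / 2) P =
        1 / 2 * quadratureSum x w Q := by
      simp only [quadratureSum, LinearMap.coe_mk, AddHom.coe_mk, hQ, eval_comp, eval_add, eval_mul,
        eval_C, eval_X, mul_sum]
      exact sum_congr rfl fun i _ => by ring
    have hM0 : 0 ≤ M := (abs_nonneg _).trans (hM 0 (by simp))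
    have hD : ∀ t ∈ Set.Icc (-1 : ℝ) 1, |(derivative^[s] Q).eval t| ≤ (1 / 2) ^ s * M := by
      intro t ht
      rw [hQ, eval_iterate_derivative_comp_affine, abs_mul, abs_of_pos (by positivity)]
      refine mul_le_mul_of_nonneg_left (hM _ ⟨?_, ?_⟩) (by positivity) <;> linarith [ht.1, ht.2]
    have key := sq_le_of_vanish_of_abs_T_le (legendreIntegral - quadratureSum x w)
      -- `128 / 63 = 2 + 2 / 63`: the weights sum to `2`, and `i ≥ 2 * k ≥ 8` bounds the integral of
      -- `T_i` by `2 / 63`.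
      (s := s) (n := 2 * k) (B := 128 / 63) (by omega) (by omega)
      (fun i hi => by
        rw [LinearMap.sub_apply, hex _ (by rw [natDegree_T, Int.natAbs_natCast]; exact hi), sub_self])
      (fun i hi => by
        have hi' : (8 : ℝ) ≤ i := by exact_mod_cast (by omega : 8 ≤ i)
        have h1 := abs_integral_T_le (n := i) (by omega)
        have h2 := abs_quadratureSum_le (x := x) hw (P := T ℝ i) (M := 1) fun j =>
          abs_eval_T_real_le_one i (abs_le.2 (hx j))
        have h3 : 2 / ((i : ℝ) ^ 2 - 1) ≤ 2 / 63 := by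
          apply div_le_div_of_nonneg_left <;> nlinarith
        rw [LinearMap.sub_apply]
        have h4 := abs_sub (legendreIntegral (T ℝ i)) (quadratureSum x w (T ℝ i))
        rw [hw2] at h2
        linarith) Q hD
    rw [LinearMap.sub_apply] at key
    rw [hI, hS, ← mul_sub]
    set R := legendreIntegral Q - quadratureSum x w Q
    have hk0 : (0 : ℝ) < k := by exact_mod_cast (by omega : 0 < k)
    have hsr : (3 : ℝ) ≤ s := by exact_mod_cast hs
    have hkr : (k : ℝ) ≤ 2 * s + 1 := by exact_mod_cast hk'
    have hE := chebyshevEnergy_pos (s := s) (n := 2 * k) (by omega)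
    have hE' := chebyshevEnergy_pos (s := s) (n := 2 * (s + 1)) (by omega)
    have hnum := chebyshevEnergy_numeric_bound hs
    have hmono := pow_mul_chebyshevEnergy_le (s := s) (by omega) hk
    set W : ℝ := ∏ i ∈ range s, (2 * (i : ℝ) + 1) / (2 * i + 2) with hW
    have hW0 : 0 < W := prod_pos fun i _ => by positivity
    have hs2 : 0 < 2 * (s : ℝ) - 2 := by linarith
    have hR : R ^ 2 ≤ (2 * (ruleConst s / k ^ s * M)) ^ 2 := by
      refine key.trans ?_
      have g1 : ((2 * k : ℕ) : ℝ) + s - 1 ≤ 5 * s + 1 := by push_cast; linarith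
      have g2 : (k : ℝ) ^ (2 * s) / chebyshevEnergy s (2 * k) ≤
          ((s + 1 : ℕ) : ℝ) ^ (2 * s) / chebyshevEnergy s (2 * (s + 1)) := by
        rwa [div_le_div_iff₀ hE hE']
      have hr : (2 * (ruleConst s / k ^ s * M)) ^ 2 =
          (Real.pi ^ 2 * (Real.exp 1 ^ 2 / 27) ^ s) * (M ^ 2 / 4 ^ s / k ^ (2 * s)) := by
        rw [show (2 * (ruleConst s / k ^ s * M)) ^ 2 =
          4 * ruleConst s ^ 2 * M ^ 2 / (k ^ s) ^ 2 by ring, four_mul_ruleConst_sq]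
        ring
      have h4 : ((1 / 2 : ℝ) ^ s * M) ^ 2 = M ^ 2 / 4 ^ s := by
        rw [mul_pow, ← pow_mul, mul_comm s 2, pow_mul]
        norm_num [div_pow]
        ring
      rw [hr, h4]
      calc _ = ((128 / 63) ^ 2 * (2 * W) * ((((2 * k : ℕ) : ℝ) + s - 1) / (2 * s - 2)) *
              (k ^ (2 * s) / chebyshevEnergy s (2 * k))) * (M ^ 2 / 4 ^ s / k ^ (2 * s)) := by
            have : (s : ℝ) - 1 ≠ 0 := by linarith
            field_simp
        _ ≤ ((128 / 63) ^ 2 * (2 * W) * ((5 * s + 1) / (2 * s - 2)) *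
              (((s + 1 : ℕ) : ℝ) ^ (2 * s) / chebyshevEnergy s (2 * (s + 1)))) *
              (M ^ 2 / 4 ^ s / k ^ (2 * s)) := by
            gcongr
        _ ≤ _ := by
            refine mul_le_mul_of_nonneg_right ?_ (by positivity)
            rwa [← mul_div_assoc]
    have h0 : 0 ≤ 2 * (ruleConst s / k ^ s * M) := by
      have := ruleConst_pos s
      positivity
    have := abs_le_of_sq_le_sq hR h0
    rw [abs_mul, abs_of_pos (by norm_num : (0 : ℝ) < 1 / 2)]
    linarith

theorem abs_eval_sub_eval_le {P : ℝ[X]} {a b M : ℝ}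
    (h : ∀ t ∈ Set.Icc a b, |(derivative P).eval t| ≤ M) {x y : ℝ} (hx : x ∈ Set.Icc a b)
    (hy : y ∈ Set.Icc a b) : |P.eval y - P.eval x| ≤ M * |y - x| :=
  (convex_Icc a b).norm_image_sub_le_of_norm_hasDerivWithin_le
    (fun t _ => (P.hasDerivAt t).hasDerivWithinAt) h hx hy

theorem ruleConst_lower_bounds : 7 / 24 ≤ ruleConst 1 ∧ 1 / 12 ≤ ruleConst 2 := by
  have he : (2.718 : ℝ) ≤ Real.exp 1 := by linarith [Real.exp_one_gt_d9]
  have hp : (3.14 : ℝ) ≤ Real.pi := by linarith [Real.pi_gt_d2]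
  have h3 : √3 ≤ 1.75 := Real.sqrt_le_iff.2 ⟨by norm_num, by norm_num⟩
  have hc : (2.718 / (6 * 1.75) : ℝ) ≤ Real.exp 1 / (6 * √3) := by gcongr
  have h : ∀ s, (3.14 : ℝ) / 2 * (2.718 / (6 * 1.75)) ^ s ≤ ruleConst s := by
    intro s
    unfold ruleConst
    gcongr
  exact ⟨le_trans (by norm_num) (h 1), le_trans (by norm_num) (h 2)⟩

theorem hasPositiveRule_midpoint {s : ℕ} (hs : 1 ≤ s) (hs' : s ≤ 2) :
    HasPositiveRule s 1 (ruleConst s / ((1 : ℕ) : ℝ) ^ s) := by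
  refine ⟨fun _ => 1 / 2, fun _ => 1, fun _ => by constructor <;> norm_num, fun _ => zero_le_one,
    by simp, fun P M hM => ?_⟩
  have hM0 : 0 ≤ M := (abs_nonneg _).trans (hM 0 (by simp))
  have hc : (1 / 2 : ℝ) ∈ Set.Icc (0 : ℝ) 1 := by constructor <;> norm_num
  have hbound : ∀ (b K : ℝ) (α β : ℝ), (∀ t ∈ Set.Icc (0 : ℝ) 1,
      |P.eval t - P.eval (1 / 2) - b * (t - 1 / 2)| ≤ α * (t - 1 / 2) ^ 2 + β) →
      α / 12 + β ≤ K → |(∫ t in (0 : ℝ)..1, P.eval t) - P.eval (1 / 2)| ≤ K := by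
    intro b K α β h hK
    have e1 : (∫ t in (0 : ℝ)..1, P.eval t) - P.eval (1 / 2) =
        ∫ t in (0 : ℝ)..1, (P.eval t - P.eval (1 / 2) - b * (t - 1 / 2)) := by
      rw [intervalIntegral.integral_sub (Continuous.intervalIntegrable (by fun_prop) _ _)
        (Continuous.intervalIntegrable (by fun_prop) _ _),
        intervalIntegral.integral_sub (Continuous.intervalIntegrable (by fun_prop) _ _)
        (Continuous.intervalIntegrable (by fun_prop) _ _)]
      norm_num
    have e2 : ∫ t in (0 : ℝ)..1, (α * (t - 1 / 2) ^ 2 + β) = α / 12 + β := by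
      rw [intervalIntegral.integral_add (Continuous.intervalIntegrable (by fun_prop) _ _)
        (Continuous.intervalIntegrable (by fun_prop) _ _), intervalIntegral.integral_const_mul,
        intervalIntegral.integral_comp_sub_right (fun t => t ^ 2)]
      norm_num
      ring
    rw [e1, ← Real.norm_eq_abs]
    refine (intervalIntegral.norm_integral_le_of_norm_le zero_le_one
      (Filter.Eventually.of_forall fun t ht => h t ⟨ht.1.le, ht.2⟩)
      (Continuous.intervalIntegrable (by fun_prop) _ _)).trans ?_
    rwa [e2]
  have hq : quadratureSum (fun _ : Fin 1 => (1 / 2 : ℝ)) (fun _ => 1) P = P.eval (1 / 2) := by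
    simp [quadratureSum]
  rw [hq, Nat.cast_one, one_pow, div_one]
  obtain rfl | rfl : s = 1 ∨ s = 2 := by omega
  · refine hbound 0 _ (3 / 2 * M) (M / 6) (fun t ht => ?_)
      (by nlinarith [ruleConst_lower_bounds.1])
    rw [zero_mul, sub_zero]
    refine (abs_eval_sub_eval_le hM hc ht).trans ?_
    -- The parabola touches at `|t - 1 / 2| = 1 / 3`. It replaces the absolute value by a polynomial
    -- and gives `1 / 8 + 1 / 6 = 7 / 24`, not sharp but enough.
    have h1 : |t - 1 / 2| ≤ 3 / 2 * (t - 1 / 2) ^ 2 + 1 / 6 := by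
      rw [← sq_abs]
      nlinarith [sq_nonneg (|t - 1 / 2| - 1 / 3)]
    nlinarith
  · refine hbound ((derivative P).eval (1 / 2)) _ M 0 (fun t ht => ?_)
      (by nlinarith [ruleConst_lower_bounds.2])
    set b := (derivative P).eval (1 / 2) with hb
    have hseg : Set.uIcc (1 / 2) t ⊆ Set.Icc (0 : ℝ) 1 := Set.uIcc_subset_Icc hc ht
    -- The mean value bound loses Taylor's factor `1 / 2`; the resulting `1 / 12` is still below
    -- `ruleConst 2`.
    have h2 := abs_eval_sub_eval_le (P := P - C b * X) (a := min (1 / 2) t) (b := max (1 / 2) t)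
      (M := M * |t - 1 / 2|) (x := 1 / 2) (y := t) (fun u hu => by
        have h3 := abs_eval_sub_eval_le (P := derivative P) hM hc (hseg hu)
        have h4 : |u - 1 / 2| ≤ |t - 1 / 2| := Set.abs_sub_left_of_mem_uIcc hu
        rw [derivative_sub, derivative_C_mul, derivative_X, mul_one, eval_sub, eval_C]
        exact h3.trans (mul_le_mul_of_nonneg_left h4 hM0))
      Set.left_mem_uIcc Set.right_mem_uIcc
    simp only [eval_sub, eval_mul, eval_C, eval_X] at h2
    rw [mul_assoc, ← sq, sq_abs] at h2
    rw [add_zero]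
    convert h2 using 2
    ring

theorem hasPositiveRule_of_lt {s n : ℕ} (hs : 1 ≤ s) (hn : s + 1 ≤ n) :
    HasPositiveRule s n (ruleConst s / n ^ s) := by
  rcases le_or_gt s 2 with h | h
  · have : ∀ n : ℕ, 1 ≤ n → HasPositiveRule s n (ruleConst s / n ^ s) := by
      intro n hn
      induction n, hn using Nat.le_induction with
      | base => exact hasPositiveRule_midpoint hs h
      | succ n hn ih => exact ih.add (hasPositiveRule_midpoint hs h) (by omega) (by omega)
    exact this n (by omega)
  · induction n using Nat.strong_induction_on with
    | _ n ih =>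
      rcases le_or_gt n (2 * s + 1) with hn' | hn'
      · exact hasPositiveRule_gauss h hn hn'
      -- Since `n ≥ 2 * s + 2`, splitting off a Gauss block of `s + 1` nodes leaves at least `s +
      -- 1`.
      · have h1 := ih (n - (s + 1)) (by omega) (by omega)
        have h2 := h1.add (hasPositiveRule_gauss h le_rfl (by omega)) (by omega) (by omega)
        rwa [Nat.sub_add_cancel hn] at h2

end UnivariateRules

/-! ### From polynomials to `C^s` functions -/

section SmoothFunctions

open Polynomial Finset

theorem exists_derivative_eq (P : ℝ[X]) : ∃ Q : ℝ[X], derivative Q = P := by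
  induction P using Polynomial.induction_on' with
  | add p q hp hq =>
    obtain ⟨P, rfl⟩ := hp
    obtain ⟨Q, rfl⟩ := hq
    exact ⟨P + Q, derivative_add⟩
  | monomial n a =>
    refine ⟨monomial (n + 1) (a / (n + 1)), ?_⟩
    rw [derivative_monomial, Nat.add_sub_cancel]
    congr 1
    push_cast
    field_simp

/-- Simultaneous polynomial approximation of a smooth function and its highest derivative. -/
theorem exists_polynomial_near_contDiffOn (s : ℕ) {f : ℝ → ℝ}
    (hf : ContDiffOn ℝ s f (Set.Icc 0 1)) {δ : ℝ} (hδ : 0 < δ) :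
    ∃ P : ℝ[X], ∀ x ∈ Set.Icc (0 : ℝ) 1, |P.eval x - f x| ≤ δ ∧
      |(derivative^[s] P).eval x - iteratedDerivWithin s f (Set.Icc 0 1) x| ≤ δ := by
  induction s generalizing f with
  | zero =>
    obtain ⟨P, hP⟩ := exists_polynomial_near_of_continuousOn 0 1 f hf.continuousOn δ hδ
    exact ⟨P, fun x hx => ⟨(hP x hx).le, by simpa using (hP x hx).le⟩⟩
  | succ s ih =>
    have hu : UniqueDiffOn ℝ (Set.Icc (0 : ℝ) 1) := uniqueDiffOn_Icc_zero_one
    have hd := (contDiffOn_succ_iff_derivWithin (n := s) hu).1 (by exact_mod_cast hf)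
    -- Approximate the derivative and integrate, matching values at `0`; on a unit interval this
    -- keeps the error at `δ`.
    obtain ⟨P', hP'⟩ := ih hd.2.2
    obtain ⟨Q, hQ⟩ := exists_derivative_eq P'
    refine ⟨Q + C (f 0 - Q.eval 0), fun x hx => ⟨?_, ?_⟩⟩
    · have h0 : (0 : ℝ) ∈ Set.Icc (0 : ℝ) 1 := by simp
      have := (convex_Icc (0 : ℝ) 1).norm_image_sub_le_of_norm_hasDerivWithin_le
        (f := fun t => (Q + C (f 0 - Q.eval 0)).eval t - f t)
        (f' := fun t => P'.eval t - derivWithin f (Set.Icc 0 1) t) (C := δ)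
        (fun t ht => by
          have h1 := ((Q + C (f 0 - Q.eval 0)).hasDerivAt t).hasDerivWithinAt
            (s := Set.Icc (0 : ℝ) 1)
          rw [derivative_add, derivative_C, add_zero, hQ] at h1
          exact h1.sub (hd.1 t ht).hasDerivWithinAt)
        (fun t ht => (hP' t ht).1) h0 hx
      simp only [eval_add, eval_C, add_sub_cancel, sub_self, sub_zero, Real.norm_eq_abs] at this ⊢
      refine this.trans ?_
      rw [abs_of_nonneg hx.1]
      nlinarith [hx.2]
    · rw [iteratedDerivWithin_succ', Function.iterate_succ_apply, derivative_add, derivative_C,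
        add_zero, hQ]
      exact (hP' x hx).2

theorem abs_integral_sub_sum_le_of_rule {s n : ℕ} {x w : Fin n → ℝ} {K : ℝ} (hK : 0 ≤ K)
    (hx : ∀ i, x i ∈ Set.Icc (0 : ℝ) 1) (hw : ∀ i, 0 ≤ w i) (hs : ∑ i, w i = 1)
    (he : ∀ (P : ℝ[X]) (M : ℝ), (∀ t ∈ Set.Icc (0 : ℝ) 1, |(derivative^[s] P).eval t| ≤ M) →
      |(∫ t in (0 : ℝ)..1, P.eval t) - quadratureSum x w P| ≤ K * M)
    {f : ℝ → ℝ} (hf : ContDiffOn ℝ s f (Set.Icc 0 1))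
    (hf' : ∀ t ∈ Set.Icc (0 : ℝ) 1, |iteratedDerivWithin s f (Set.Icc 0 1) t| ≤ 1) :
    |(∫ t in (0 : ℝ)..1, f t) - ∑ i, w i * f (x i)| ≤ K := by
  refine le_of_forall_pos_le_add fun ε hε => ?_
  set δ := ε / (K + 2) with hδ
  have hδ0 : 0 < δ := by positivity
  obtain ⟨P, hP⟩ := exists_polynomial_near_contDiffOn s hf hδ0
  have h1 := he P (1 + δ) fun t ht => by
    have := abs_sub_abs_le_abs_sub ((derivative^[s] P).eval t)
      (iteratedDerivWithin s f (Set.Icc 0 1) t)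
    linarith [(hP t ht).2, hf' t ht]
  have hfi : IntervalIntegrable f volume 0 1 :=
    (by simpa [Set.uIcc_of_le] using hf.continuousOn :
      ContinuousOn f (Set.uIcc 0 1)).intervalIntegrable
  have h2 : |(∫ t in (0 : ℝ)..1, P.eval t) - ∫ t in (0 : ℝ)..1, f t| ≤ δ := by
    rw [← intervalIntegral.integral_sub (Continuous.intervalIntegrable (by fun_prop) _ _) hfi]
    have := intervalIntegral.norm_integral_le_of_norm_le_const (a := (0 : ℝ)) (b := 1) (C := δ)
      (f := fun t => P.eval t - f t) fun t ht => by
        rw [Set.uIoc_of_le zero_le_one] at ht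
        exact (hP t ⟨ht.1.le, ht.2⟩).1
    simpa using this
  have h3 : |quadratureSum x w P - ∑ i, w i * f (x i)| ≤ δ := by
    simp only [quadratureSum, LinearMap.coe_mk, AddHom.coe_mk, ← sum_sub_distrib, ← mul_sub]
    refine (abs_sum_le_sum_abs (fun i => w i * (P.eval (x i) - f (x i))) univ).trans ?_
    calc _ ≤ ∑ i, w i * δ := sum_le_sum fun i _ => by
          rw [abs_mul, abs_of_nonneg (hw i)]
          exact mul_le_mul_of_nonneg_left (hP _ (hx i)).1 (hw i)
      _ = δ := by rw [← sum_mul, hs, one_mul]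
  have h4 : K * (1 + δ) + 2 * δ = K + ε := by
    rw [hδ]; field_simp; ring
  rw [abs_le] at h1 h2 h3 ⊢
  constructor <;> linarith [h1.1, h1.2, h2.1, h2.2, h3.1, h3.2]

end SmoothFunctions

/-! ### Product rules -/

section ProductRules

open Finset

/-- The product rule built from a univariate rule with nonnegative weights that sum to one has
error at most `d` times the error of the univariate rule on the sections. -/
theorem abs_integral_pi_sub_sum_le {n : ℕ} {x w : Fin n → ℝ} (hw : ∀ i, 0 ≤ w i)
    (hs : ∑ i, w i = 1) {μ : Measure ℝ} [IsProbabilityMeasure μ] {e B : ℝ} (d : ℕ)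
    {F : (Fin d → ℝ) → ℝ} (hF : Continuous F) (hB : ∀ y, |F y| ≤ B)
    (hsec : ∀ y j, |(∫ t, F (Function.update y j t) ∂μ) -
      ∑ i, w i * F (Function.update y j (x i))| ≤ e) :
    |(∫ y, F y ∂Measure.pi fun _ => μ) -
      ∑ k : Fin d → Fin n, (∏ j, w (k j)) * F fun j => x (k j)| ≤ d * e := by
  induction d with
  | zero =>
    rw [Measure.pi_of_empty _ (fun j => x (Fin.elim0 j)), integral_dirac]
    have : ∀ k : Fin 0 → Fin n, (fun j => x (k j)) = fun j => x (Fin.elim0 j) :=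
      fun k => Subsingleton.elim _ _
    simp [this]
  | succ d ih =>
    have hcons : Continuous fun p : ℝ × (Fin d → ℝ) => F (Fin.cons p.1 p.2) := by
      refine hF.comp (continuous_pi fun j => ?_)
      refine Fin.cases ?_ (fun j => ?_) j
      · simpa using continuous_fst
      · simp only [Fin.cons_succ]; fun_prop
    set ν : Measure (Fin d → ℝ) := Measure.pi fun _ => μ with hν
    have hint : Integrable (fun p : ℝ × (Fin d → ℝ) => F (Fin.cons p.1 p.2)) (μ.prod ν) :=
      Integrable.of_bound hcons.aestronglyMeasurable B (Filter.Eventually.of_forall fun p => hB _)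
    have hI : ∫ y, F y ∂(Measure.pi fun _ : Fin (d + 1) => μ) =
        ∫ z, ∫ t, F (Fin.cons t z) ∂μ ∂ν := by
      rw [← ((measurePreserving_piFinSuccAbove (fun _ => μ) 0).symm).integral_comp',
        ← integral_prod_symm _ hint]
      simp only [MeasurableEquiv.piFinSuccAbove_symm_apply, Fin.insertNthEquiv, Equiv.coe_fn_mk,
        Fin.insertNth_zero]
      rfl
    have hS : ∑ k : Fin (d + 1) → Fin n, (∏ j, w (k j)) * F (fun j => x (k j)) =
        ∑ i, w i * ∑ k : Fin d → Fin n, (∏ j, w (k j)) * F (Fin.cons (x i) fun j => x (k j)) := by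
      rw [← (Fin.consEquiv fun _ => Fin n).sum_comp, Fintype.sum_prod_type]
      refine sum_congr rfl fun i _ => ?_
      rw [mul_sum]
      refine sum_congr rfl fun k _ => ?_
      rw [Fin.prod_univ_succ, ← mul_assoc]
      congr 2
      funext j
      refine Fin.cases ?_ (fun j => ?_) j <;> simp [Fin.consEquiv]
    have hint_i : ∀ i, Integrable (fun z => F (Fin.cons (x i) z)) ν := fun i =>
      Integrable.of_bound (hcons.comp (by fun_prop : Continuous fun z : Fin d → ℝ =>
        (x i, z))).aestronglyMeasurable B (Filter.Eventually.of_forall fun p => hB _)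
    have h1 : |(∫ z, ∫ t, F (Fin.cons t z) ∂μ ∂ν) - ∑ i, w i * ∫ z, F (Fin.cons (x i) z) ∂ν| ≤
        e := by
      have : ∑ i, w i * ∫ z, F (Fin.cons (x i) z) ∂ν =
          ∫ z, ∑ i, w i * F (Fin.cons (x i) z) ∂ν := by
        rw [integral_finsetSum _ fun i _ => (hint_i i).const_mul _]
        simp_rw [integral_const_mul]
      rw [this, ← integral_sub hint.integral_prod_right
        (integrable_finsetSum _ fun i _ => (hint_i i).const_mul _)]
      have hb := norm_integral_le_of_norm_le_const (μ := ν) (C := e)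
        (f := fun z => (∫ t, F (Fin.cons t z) ∂μ) - ∑ i, w i * F (Fin.cons (x i) z))
        (Filter.Eventually.of_forall fun z => by
          have := hsec (Fin.cons 0 z) 0
          simpa only [Fin.update_cons_zero, Real.norm_eq_abs] using this)
      simpa using hb
    have h2 : ∀ i, |(∫ z, F (Fin.cons (x i) z) ∂ν) -
        ∑ k : Fin d → Fin n, (∏ j, w (k j)) * F (Fin.cons (x i) fun j => x (k j))| ≤ d * e :=
      fun i => ih (F := fun z => F (Fin.cons (x i) z)) (hcons.comp (by fun_prop :
        Continuous fun z : Fin d → ℝ => (x i, z))) (fun y => hB _) fun y j => by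
          simpa only [Fin.cons_update] using hsec (Fin.cons (x i) y) j.succ
    have h3 : |(∑ i, w i * ∫ z, F (Fin.cons (x i) z) ∂ν) - ∑ i, w i * ∑ k : Fin d → Fin n,
        (∏ j, w (k j)) * F (Fin.cons (x i) fun j => x (k j))| ≤ d * e := by
      rw [← sum_sub_distrib]
      refine (abs_sum_le_sum_abs _ _).trans ?_
      calc _ ≤ ∑ i, w i * (d * e) := sum_le_sum fun i _ => by
            rw [← mul_sub, abs_mul, abs_of_nonneg (hw i)]
            exact mul_le_mul_of_nonneg_left (h2 i) (hw i)
        _ = d * e := by rw [← sum_mul, hs, one_mul]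
    rw [hI, hS]
    refine (abs_sub_le _ _ _).trans ((add_le_add h1 h3).trans_eq ?_)
    push_cast
    ring

end ProductRules

/-! ### Sections of functions in the smooth ball -/

section SmoothBall

theorem partialDeriv_zero {d : ℕ} (j : Fin d) (f : (Fin d → ℝ) → ℝ) : partialDeriv j 0 f = f := by
  funext x
  simp [partialDeriv]

theorem multiDeriv_zero {d : ℕ} (f : (Fin d → ℝ) → ℝ) : multiDeriv 0 f = f := by
  unfold multiDeriv
  induction List.finRange d with
  | nil => rfl
  | cons i l ih => rw [List.foldr_cons, ih, Pi.zero_apply, partialDeriv_zero]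

theorem multiDeriv_single {d : ℕ} (j : Fin d) (s : ℕ) (f : (Fin d → ℝ) → ℝ) :
    multiDeriv (Pi.single j s) f = partialDeriv j s f := by
  have key : ∀ l : List (Fin d), l.Nodup →
      l.foldr (fun i g => partialDeriv i ((Pi.single j s : Fin d → ℕ) i) g) f =
        if j ∈ l then partialDeriv j s f else f := by
    intro l hl
    induction l with
    | nil => simp
    | cons i l ih =>
      rw [List.nodup_cons] at hl
      rw [List.foldr_cons, ih hl.2]
      rcases eq_or_ne i j with rfl | h
      · simp [hl.1]
      · simp [h, h.symm, partialDeriv_zero]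
  simpa [multiDeriv] using key _ (List.nodup_finRange d)

theorem abs_le_one_of_mem_smoothBall {d r : ℕ} {f : (Fin d → ℝ) → ℝ} (hf : f ∈ smoothBall d r)
    {x : Fin d → ℝ} (hx : x ∈ unitCube d) : |f x| ≤ 1 := by
  have := hf.2 0 (by simp) x hx
  rwa [multiDeriv_zero] at this

theorem update_mem_unitCube {d : ℕ} {x : Fin d → ℝ} (hx : x ∈ unitCube d) (j : Fin d) {t : ℝ}
    (ht : t ∈ Icc (0 : ℝ) 1) : Function.update x j t ∈ unitCube d := by
  constructor <;> intro i <;> rcases eq_or_ne i j with rfl | h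
  · simpa using ht.1
  · simpa [h] using hx.1 i
  · simpa using ht.2
  · simpa [h] using hx.2 i

theorem contDiffOn_section {d r s : ℕ} (hs : s ≤ r) {f : (Fin d → ℝ) → ℝ}
    (hf : f ∈ smoothBall d r) {x : Fin d → ℝ} (hx : x ∈ unitCube d) (j : Fin d) :
    ContDiffOn ℝ s (fun t => f (Function.update x j t)) (Icc 0 1) :=
  (hf.1.of_le (by exact_mod_cast hs)).comp (contDiff_update _ x j).contDiffOn
    fun _ ht => update_mem_unitCube hx j ht

theorem abs_iteratedDerivWithin_section_le {d r s : ℕ} (hs : s ≤ r) {f : (Fin d → ℝ) → ℝ}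
    (hf : f ∈ smoothBall d r) {x : Fin d → ℝ} (hx : x ∈ unitCube d) (j : Fin d) {t : ℝ}
    (ht : t ∈ Icc (0 : ℝ) 1) :
    |iteratedDerivWithin s (fun t => f (Function.update x j t)) (Icc 0 1) t| ≤ 1 := by
  have := hf.2 (Pi.single j s) (by simpa using hs) _ (update_mem_unitCube hx j ht)
  rw [multiDeriv_single] at this
  simpa [partialDeriv] using this

theorem cubeIntegral_eq_integral_pi {d : ℕ} (f : (Fin d → ℝ) → ℝ) :
    cubeIntegral d f = ∫ y, f y ∂Measure.pi fun _ => volume.restrict (Icc (0 : ℝ) 1) := by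
  rw [cubeIntegral, unitCube, ← Set.pi_univ_Icc, volume_pi, Measure.restrict_pi_pi]
  rfl

/-- The error of a product rule on the unit ball of `C^r([0,1]^d)`. -/
theorem abs_cubeIntegral_sub_sum_le {d r s n : ℕ} (hs : s ≤ r) {x w : Fin n → ℝ} {K : ℝ}
    (hK : 0 ≤ K) (hx : ∀ i, x i ∈ Icc (0 : ℝ) 1) (hw : ∀ i, 0 ≤ w i) (hw1 : ∑ i, w i = 1)
    (he : ∀ (P : Polynomial ℝ) (M : ℝ),
      (∀ t ∈ Icc (0 : ℝ) 1, |(Polynomial.derivative^[s] P).eval t| ≤ M) →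
      |(∫ t in (0 : ℝ)..1, P.eval t) - quadratureSum x w P| ≤ K * M)
    {f : (Fin d → ℝ) → ℝ} (hf : f ∈ smoothBall d r) :
    |cubeIntegral d f - ∑ k : Fin d → Fin n, (∏ j, w (k j)) * f fun j => x (k j)| ≤ d * K := by
  let μ : Measure ℝ := volume.restrict (Icc (0 : ℝ) 1)
  have hμ : IsProbabilityMeasure μ := ⟨by simp [μ]⟩
  -- Clamping each coordinate to `[0, 1]` makes `F` continuous and bounded on the whole space
  -- without changing it on the cube.
  let p : ℝ → ℝ := fun t => projIcc (0 : ℝ) 1 zero_le_one t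
  have hp : ∀ t, p t ∈ Icc (0 : ℝ) 1 := fun t => (projIcc (0 : ℝ) 1 zero_le_one t).2
  have hp' : ∀ t ∈ Icc (0 : ℝ) 1, p t = t := fun t ht => by
    simp only [p, projIcc_of_mem zero_le_one ht]
  have hpc : Continuous p := continuous_subtype_val.comp continuous_projIcc
  let F : (Fin d → ℝ) → ℝ := fun y => f fun j => p (y j)
  have hmem : ∀ y : Fin d → ℝ, (fun j => p (y j)) ∈ unitCube d := fun y =>
    ⟨fun j => (hp _).1, fun j => (hp _).2⟩
  have hF : Continuous F := hf.1.continuousOn.comp_continuous (by fun_prop) hmem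
  have hupd : ∀ (y : Fin d → ℝ) (j : Fin d), ∀ t ∈ Icc (0 : ℝ) 1,
      F (Function.update y j t) = f (Function.update (fun i => p (y i)) j t) := by
    intro y j t ht
    refine congrArg f (funext fun i => ?_)
    rcases eq_or_ne i j with rfl | h
    · simp [hp' t ht]
    · simp [h]
  have key := abs_integral_pi_sub_sum_le hw hw1 (μ := μ) (e := K) (B := 1) d hF
    (fun y => abs_le_one_of_mem_smoothBall hf (hmem y)) fun y j => by
      have h1 := abs_integral_sub_sum_le_of_rule hK hx hw hw1 he
        (contDiffOn_section hs hf (hmem y) j)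
        fun t ht => abs_iteratedDerivWithin_section_le hs hf (hmem y) j ht
      have h2 : ∫ t, F (Function.update y j t) ∂μ =
          ∫ t in (0 : ℝ)..1, f (Function.update (fun i => p (y i)) j t) := by
        rw [intervalIntegral.integral_of_le zero_le_one, ← integral_Icc_eq_integral_Ioc]
        exact setIntegral_congr_fun measurableSet_Icc (hupd y j)
      have h3 : ∑ i, w i * F (Function.update y j (x i)) =
          ∑ i, w i * f (Function.update (fun i => p (y i)) j (x i)) :=
        Finset.sum_congr rfl fun i _ => by rw [hupd y j _ (hx i)]
      rw [h2, h3]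
      exact h1
  have hI : cubeIntegral d f = ∫ y, F y ∂Measure.pi fun _ => μ := by
    rw [← cubeIntegral_eq_integral_pi]
    refine setIntegral_congr_fun measurableSet_Icc fun y hy => congrArg f (funext fun j => ?_)
    exact (hp' _ ⟨hy.1 j, hy.2 j⟩).symm
  have hS : ∀ k : Fin d → Fin n, F (fun j => x (k j)) = f fun j => x (k j) := fun k =>
    congrArg f (funext fun j => hp' _ (hx _))
  rw [hI]
  simpa only [hS] using key

end SmoothBall

/-! ### The algorithm and the final bound -/

section ProductAlgorithm

/-- The nonadaptive algorithm given by the product rule with univariate nodes `x` and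
weights `w`. -/
noncomputable def productAlgorithm (d : ℕ) {n : ℕ} (x : Fin n → Icc (0 : ℝ) 1) (w : Fin n → ℝ) :
    SamplingAlgorithm d (n ^ d) where
  node i _ := ⟨fun j => x (finFunctionFinEquiv.symm i j), fun _ => (x _).2.1, fun _ => (x _).2.2⟩
  output v := ∑ k : Fin d → Fin n, (∏ j, w (k j)) * v (finFunctionFinEquiv k)

theorem productAlgorithm_run {d n : ℕ} (x : Fin n → Icc (0 : ℝ) 1) (w : Fin n → ℝ)
    (f : (Fin d → ℝ) → ℝ) : (productAlgorithm d x w).run f =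
      ∑ k : Fin d → Fin n, (∏ j, w (k j)) * f fun j => x (k j) := by
  unfold SamplingAlgorithm.run
  refine Finset.sum_congr rfl fun k _ => ?_
  rw [SamplingAlgorithm.value]
  simp [productAlgorithm]

theorem minimalNumber_le_of_rule {d r s m : ℕ} (hs : s ≤ r) {ε K : ℝ} (hK : 0 ≤ K)
    (h : HasPositiveRule s m K) (hε : d * K ≤ ε) : minimalNumber ε d r ≤ (m ^ d : ℕ) := by
  obtain ⟨x, w, hx, hw, hw1, he⟩ := h
  refine iInf₂_le (m ^ d) ?_
  refine (iInf_le (fun A : SamplingAlgorithm d (m ^ d) => A.worstCaseError r)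
    (productAlgorithm d (fun i => ⟨x i, hx i⟩) w)).trans (iSup₂_le fun f hf => ?_)
  rw [productAlgorithm_run]
  exact ENNReal.ofReal_le_ofReal
    ((abs_cubeIntegral_sub_sum_le hs hK hx hw hw1 he hf).trans hε)

end ProductAlgorithm

theorem mainTheorem4 (r d : ℕ) (hr : 1 ≤ r) (hd : 1 ≤ d) (ε : ℝ) (hε : ε ∈ Set.Ioo (0 : ℝ) 1) :
    minimalNumber ε d r ≤
      (((Finset.Icc 1 r).inf' (Finset.nonempty_Icc.mpr hr) fun s : ℕ =>
        max ((s + 1) ^ d)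
          (⌈(Real.pi / 2 * (Real.exp 1 / (6 * √3)) ^ s * ((d : ℝ) / ε)) ^ (1 / (s : ℝ))⌉₊ ^ d) :
        ℕ) : ℕ∞) := by
  obtain ⟨s, hs, heq⟩ := Finset.exists_mem_eq_inf' (Finset.nonempty_Icc.mpr hr) fun s : ℕ =>
    max ((s + 1) ^ d)
      (⌈(Real.pi / 2 * (Real.exp 1 / (6 * √3)) ^ s * ((d : ℝ) / ε)) ^ (1 / (s : ℝ))⌉₊ ^ d)
  rw [heq]
  obtain ⟨hs1, hsr⟩ := Finset.mem_Icc.1 hs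
  change minimalNumber ε d r ≤ ((max ((s + 1) ^ d)
    (⌈(ruleConst s * ((d : ℝ) / ε)) ^ (1 / (s : ℝ))⌉₊ ^ d) : ℕ) : ℕ∞)
  set c := ⌈(ruleConst s * ((d : ℝ) / ε)) ^ (1 / (s : ℝ))⌉₊ with hc
  -- `s + 1 ≤ m` makes the univariate rule available, and `c ≤ m` gives `d * ruleConst s / m ^ s ≤
  -- ε`.
  set m := max (s + 1) c with hm
  have hmax : max ((s + 1) ^ d) (c ^ d) = m ^ d :=
    ((pow_left_mono d).map_max (a := s + 1) (b := c)).symm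
  rw [hmax]
  have hA := ruleConst_pos s
  have hm0 : (0 : ℝ) < m := by
    exact_mod_cast (Nat.succ_pos s).trans_le (le_max_left (s + 1) c)
  refine minimalNumber_le_of_rule hsr (by positivity)
    (hasPositiveRule_of_lt hs1 (le_max_left (s + 1) c)) ?_
  have h0 : 0 ≤ ruleConst s * ((d : ℝ) / ε) := by
    have := hε.1
    positivity
  have h1 : (ruleConst s * ((d : ℝ) / ε)) ^ (1 / (s : ℝ)) ≤ m :=
    (Nat.le_ceil _).trans (by exact_mod_cast le_max_right (s + 1) c)
  have h2 : ruleConst s * ((d : ℝ) / ε) ≤ (m : ℝ) ^ s := by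
    have := pow_le_pow_left₀ (Real.rpow_nonneg h0 _) h1 s
    rwa [one_div, Real.rpow_inv_natCast_pow h0 (by omega)] at this
  rw [← mul_div_assoc, div_le_iff₀ hε.1] at h2
  rw [← mul_div_assoc, div_le_iff₀ (by positivity)]
  linarith
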